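/- Let $q\ge 5$ be a prime power with $q\equiv 0\pmod 3$. In $\mathrm{PG}(3,q)$ put $P(t)=(t^3,t^2,t,1)$ for $t\in\mathbb F_q$ and $P(\infty)=(1,0,0,0)$, let $\mathcal C=\{P(t): t\in\mathbb F_q\cup\{\infty\}\}$ be the twisted cubic, and let $G_q$ be the group of projectivities of $\mathrm{PG}(3,q)$ that map $\mathcal C$ onto itself. The osculating plane at $P(t)$ is $x_0-3tx_1+3t^2x_2-t^3x_3=0$ for $t\in\mathbb F_q$ and $x_3=0$ for $t=\infty$; the $q+1$ osculating planes form a pencil, whose common line is called the axis. A chord of $\mathcal C$ is a line through two distinct points of $\mathcal C$, a tangent to $\mathcal C$, or a line whose extension to $\mathbb F_{q^2}$ passes through two conjugate points $P(t),P(t^q)$ with $t\in\mathbb F_{q^2}\setminus\mathbb F_q$; a line is external if it contains no point of $\mathcal C$. * A $\mathrm{TO}$-point is a point off $\mathcal C$ that lies on a tangent to $\mathcal C$ and on exactly one osculating plane. * An $\mathrm{EA}$-line is an external line, other than the axis, that meets the axis. * An $\mathrm{En\Gamma}$-line is an external line that is not a chord and does not lie in any osculating plane. The $\mathrm{EA}$-lines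 form exactly three orbits under $G_q$: $\mathrm{EA}_1$ of size $q^3-q$, and $\mathrm{EA}_2$, $\mathrm{EA}_3$, each of size $(q^2-1)/2$. Moreover: 1. Through every $\mathrm{TO}$-point there pass exactly $q$ $\mathrm{EA}$-lines, all of them in the orbit $\mathrm{EA}_1$ (so no line of $\mathrm{EA}_2$ or $\mathrm{EA}_3$ contains a $\mathrm{TO}$-point), and exactly $q^2-q$ $\mathrm{En\Gamma}$-lines. 2. The average number of $\mathrm{TO}$-points on an $\mathrm{EA}$-line, over all $\mathrm{EA}$-lines, is $\dfrac{q}{q+1}$, and the average number of $\mathrm{TO}$-points on an $\mathrm{En\Gamma}$-line, over all $\mathrm{En\Gamma}$-lines, is $1$. 3. Every line of $\mathrm{EA}_1$ contains exactly one $\mathrm{TO}$-point, and every line of $\mathrm{EA}_2\cup\mathrm{EA}_3$ contains none. -/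

import Mathlib

open scoped Pointwise LinearAlgebra.Projectivization

namespace TwistedCubic

/-- The underlying vector space of `PG(3,K)`, with coordinates `x₀, x₁, x₂, x₃`. -/
abbrev V (K : Type*) : Type _ := Fin 4 → K

/-- The coordinate vector of the point `P(t)`, `t ∈ K ∪ {∞}`:
`(t³, t², t, 1)` for `t ∈ K` and `(1, 0, 0, 0)` for `t = ∞`. -/
def vec {K : Type*} [Field K] : OnePoint K → V K
  | OnePoint.infty => ![1, 0, 0, 0]
  | OnePoint.some t => ![t ^ 3, t ^ 2, t, 1]

theorem vec_ne_zero {K : Type*} [Field K] (t : OnePoint K) : vec t ≠ 0 := by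
  induction t using OnePoint.rec with
  | infty => exact fun h => one_ne_zero (congrFun h 0)
  | coe t => exact fun h => one_ne_zero (congrFun h 3)

/-- The derivative vector of the parametrization at `t`; at `t = ∞` the derivative at `s = 0` of
the parametrization `(1, s, s², s³)` near `P(∞)`. -/
def tangentVec {K : Type*} [Field K] : OnePoint K → V K
  | OnePoint.infty => ![0, 1, 0, 0]
  | OnePoint.some t => ![3 * t ^ 2, 2 * t, 1, 0]

section

variable (F : Type*) [Field F]

/-- The twisted cubic `C = {P(t) : t ∈ F ∪ {∞}}`, a set of points of `PG(3,F)`. -/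
def cubic : Set (ℙ F (V F)) :=
  Set.range fun t : OnePoint F => Projectivization.mk F (vec t) (vec_ne_zero t)

/-- The group fixing the twisted cubic (as a set of points): the linear automorphisms of `F⁴`
inducing a projectivity of `PG(3,F)` that fixes `C`. It is the full preimage in `GL(4,F)` of the
group `G_q` of projectivities, and scalars act trivially on points and lines, so that its orbits
of points and lines are those of `G_q`. -/
def G : Subgroup (V F ≃ₗ[F] V F) := MulAction.stabilizer (V F ≃ₗ[F] V F) (cubic F)

/-- The plane with equation `c₀x₀ + c₁x₁ + c₂x₂ + c₃x₃ = 0`. -/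
def plane (c : V F) : Submodule F (V F) where
  carrier := {x | c 0 * x 0 + c 1 * x 1 + c 2 * x 2 + c 3 * x 3 = 0}
  zero_mem' := by simp
  add_mem' := by
    intro x y hx hy
    simp only [Set.mem_ofPred_eq, Pi.add_apply] at *
    linear_combination hx + hy
  smul_mem' := by
    intro a x hx
    simp only [Set.mem_ofPred_eq, Pi.smul_apply, smul_eq_mul] at *
    linear_combination a * hx

/-- The osculating plane of the twisted cubic at `P(t)`. -/
def oscPlane : OnePoint F → Submodule F (V F)
  | OnePoint.infty => plane F ![0, 0, 0, 1]
  | OnePoint.some t => plane F ![1, -3 * t, 3 * t ^ 2, -t ^ 3]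

/-- The osculating developable `Γ`: the set of osculating planes. -/
def oscPlanes : Set (Submodule F (V F)) := Set.range (oscPlane F)

/-- The axis of the pencil of osculating planes, that is, their common intersection
(a line in characteristic `3`). -/
def axis : Submodule F (V F) := ⨅ t : OnePoint F, oscPlane F t

variable {F}

/-- Lines of `PG(3,F)`: the two-dimensional subspaces of `F⁴`. -/
def IsLine (ℓ : Submodule F (V F)) : Prop := Module.finrank F ℓ = 2

/-- The point `p` lies on the line or plane `W`. -/
def OnSub (p : ℙ F (V F)) (W : Submodule F (V F)) : Prop := p.submodule ≤ W

/-- The line `ℓ` contains two distinct points of the twisted cubic. -/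
def IsRealChord (ℓ : Submodule F (V F)) : Prop :=
  IsLine ℓ ∧ ∃ P ∈ cubic F, ∃ Q ∈ cubic F, P ≠ Q ∧ OnSub P ℓ ∧ OnSub Q ℓ

/-- The line `ℓ` is the tangent to the twisted cubic at one of its points. -/
def IsTangent (ℓ : Submodule F (V F)) : Prop :=
  ∃ t : OnePoint F, ℓ = Submodule.span F {vec t, tangentVec t}

/-- The scalar extension of a subspace of `F⁴` to a subspace of `K⁴`. -/
def extend (K : Type*) [Field K] [Algebra F K] (W : Submodule F (V F)) : Submodule K (V K) :=
  Submodule.span K ((fun (v : V F) (i : Fin 4) => algebraMap F K (v i)) '' (W : Set (V F)))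

/-- The line `ℓ` is an imaginary chord: over an extension field it is the line through two
conjugate points `P(t)`, `P(t^q)` of the cubic, where `t` lies in `𝔽_{q²}` but not in `𝔽_q`,
`q` being the order of `F`. -/
def IsImaginaryChord (ℓ : Submodule F (V F)) : Prop :=
  IsLine ℓ ∧ ∃ t : AlgebraicClosure F, t ^ (Nat.card F) ^ 2 = t ∧ t ^ Nat.card F ≠ t ∧
    extend (AlgebraicClosure F) ℓ =
      Submodule.span (AlgebraicClosure F)
        {vec (OnePoint.some t), vec (OnePoint.some (t ^ Nat.card F))}

/-- Chords of the twisted cubic: real chords, tangents and imaginary chords. -/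
def IsChord (ℓ : Submodule F (V F)) : Prop :=
  IsRealChord ℓ ∨ IsTangent ℓ ∨ IsImaginaryChord ℓ

/-- An external line: a line without points of the twisted cubic. -/
def IsExternal (ℓ : Submodule F (V F)) : Prop :=
  IsLine ℓ ∧ ∀ P ∈ cubic F, ¬ OnSub P ℓ

variable (F)

/-- `TO`-points (characteristic `3`): points off the cubic, on a tangent, and on exactly one
osculating plane. -/
def TOPoints : Set (ℙ F (V F)) :=
  {p | p ∉ cubic F ∧ (∃ ℓ, IsTangent ℓ ∧ OnSub p ℓ) ∧ ∃! π, π ∈ oscPlanes F ∧ OnSub p π}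

/-- `EA`-lines (characteristic `3`): external lines, other than the axis itself, that meet the
axis in a point. -/
def EALines : Set (Submodule F (V F)) :=
  {ℓ | IsExternal ℓ ∧ ℓ ≠ axis F ∧ ∃ p : ℙ F (V F), OnSub p ℓ ∧ OnSub p (axis F)}

/-- `EnΓ`-lines: external lines, other than chords, that lie in no osculating plane. -/
def EnGLines : Set (Submodule F (V F)) :=
  {ℓ | IsExternal ℓ ∧ ¬ IsChord ℓ ∧ ∀ π ∈ oscPlanes F, ¬ ℓ ≤ π}

variable {F}

/-- `O` is an orbit of lines under the group of the twisted cubic. -/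
def IsLineOrbit (O : Set (Submodule F (V F))) : Prop :=
  ∃ ℓ : Submodule F (V F), IsLine ℓ ∧ O = MulAction.orbit (G F) ℓ

/-- The number of lines of the set `L` through the point `p`. -/
noncomputable def numLines (L : Set (Submodule F (V F))) (p : ℙ F (V F)) : ℕ :=
  {ℓ | ℓ ∈ L ∧ OnSub p ℓ}.ncard

/-- The number of points of the set `M` on the line `ℓ`. -/
noncomputable def numPoints (M : Set (ℙ F (V F))) (ℓ : Submodule F (V F)) : ℕ :=
  {p | p ∈ M ∧ OnSub p ℓ}.ncard

/-- The average number of points of the set `M` on a line of the finite set `L`. -/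
noncomputable def avgPoints (M : Set (ℙ F (V F))) (L : Set (Submodule F (V F))) : ℚ :=
  (∑ᶠ ℓ ∈ L, (numPoints M ℓ : ℚ)) / (L.ncard : ℚ)

end

end TwistedCubic

/-!
In characteristic `3` the osculating plane at `P(t)` is `x₀ = t³ x₃`, resp. `x₃ = 0`, and the axis is
`x₀ = x₃ = 0`. Cubing is a bijection of `F`, so each point off the axis lies in exactly one
osculating plane, where it has affine coordinates `y, z` with respect to `P(s)`, the point
`axisPt s` in which the tangent meets the axis, and a second point of the axis (`pt`). The
`TO`-points are the points `z = 0`, `y ≠ 0`: there are `(q + 1)(q - 1)` of them.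

*Lines meeting the axis.* Such a line, other than the axis, joins some `axisPt t` to some `pt s y z`.
If `t ≠ s`, it meets the tangent at `P(s)` in a single point, which is a `TO`-point when the line is
external (`transversalLines`). If `t = s`, it is a line `z = c` with `c ≠ 0`, and contains no
`TO`-point (`concurrentLines`). The numbers of lines and incidences can be read off. For the
orbits, the group `G` has to be known. It is doubly transitive on the cubic, and an element fixing
`P(∞)` and `P(0)` is a diagonal map induced by `t ↦ k t` up to a scalar: the equations of the cubic
applied to the image of `P(t)` have degree at most `5` in `t`, so for `q > 5` they hold
coefficientwise (`exists_eq_smul_scale`). Hence every element of `G` permutes the frames of the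
osculating planes, multiplying `z` by a square (`ActsBy`, `exists_actsBy_of_mem_G`); this makes
`transversalLines` a single orbit, and splits the lines `z = c` into two orbits according to the
quadratic character of `c`.

*Lines skew to the axis.* The lines in no osculating plane are the `q⁴` lines skew to the axis. Among
the `q²` of these through a point of the tangent at `P(s)`, off the axis, exactly `q` contain a point
of the cubic other than `P(s)` (`ncard_unisecants`). Applied to a `TO`-point, which is on no
imaginary chord, this counts the `EnΓ`-lines through it; applied to `P(s)`, it counts the lines skew
to the axis that have just one point on the cubic. The real and imaginary chords are the lines
`chordLine u v` attached to the quadratics `X² - u X + v` without a double root, plus the `q` chords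
through `P(∞)`. Removing the unisecants and the chords leaves `(q² - 1)(q² - q)` `EnΓ`-lines
(`ncard_EnGLines_add`), as many as there are incident pairs of a `TO`-point and an `EnΓ`-line.
-/

namespace TwistedCubic

/-! ### Coordinates adapted to the osculating planes -/

section Coordinates

theorem V_ext_iff {F : Type*} {x y : V F} :
    x = y ↔ x 0 = y 0 ∧ x 1 = y 1 ∧ x 2 = y 2 ∧ x 3 = y 3 := by
  constructor
  · rintro rfl; simp
  · rintro ⟨h0, h1, h2, h3⟩
    ext i; fin_cases i <;> assumption

variable {F : Type*} [Field F]

@[simp] theorem vec_infty : vec (OnePoint.infty : OnePoint F) = ![1, 0, 0, 0] := rfl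

@[simp] theorem vec_coe (t : F) : vec (t : OnePoint F) = ![t ^ 3, t ^ 2, t, 1] := rfl

/-- The point in which the tangent at `P(t)` meets the axis, in characteristic `3`. -/
def axisPt : OnePoint F → V F
  | OnePoint.infty => ![0, 1, 0, 0]
  | OnePoint.some t => ![0, -t, 1, 0]

@[simp] theorem axisPt_infty : axisPt (OnePoint.infty : OnePoint F) = ![0, 1, 0, 0] := rfl

@[simp] theorem axisPt_coe (t : F) : axisPt (t : OnePoint F) = ![0, -t, 1, 0] := rfl

/-- The point of the osculating plane at `P(s)`, off the axis, with affine coordinates `y, z` in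
the frame with origin `P(s)` and first direction `axisPt s`: the tangent at `P(s)` is `z = 0`.
Every point off the axis has a unique such representation. -/
def pt : OnePoint F → F → F → V F
  | OnePoint.infty, y, z => ![1, y, z, 0]
  | OnePoint.some s, y, z => ![s ^ 3, s ^ 2 - s * y + z, s + y, 1]

@[simp] theorem pt_infty (y z : F) : pt (OnePoint.infty : OnePoint F) y z = ![1, y, z, 0] := rfl

@[simp] theorem pt_coe (s y z : F) :
    pt (s : OnePoint F) y z = ![s ^ 3, s ^ 2 - s * y + z, s + y, 1] := rfl

theorem vec_eq_pt (s : OnePoint F) : vec s = pt s 0 0 := by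
  induction s using OnePoint.rec <;> simp

theorem axisPt_ne_zero (t : OnePoint F) : axisPt t ≠ 0 := by
  induction t using OnePoint.rec <;> simp

theorem pt_ne_zero (s : OnePoint F) (y z : F) : pt s y z ≠ 0 := by
  induction s using OnePoint.rec <;> simp

theorem pt_add_axisPt_self (s : OnePoint F) (y z c : F) :
    pt s y z + c • axisPt s = pt s (y + c) z := by
  induction s using OnePoint.rec
  · simp
  · simp; constructor <;> ring

/-- Expansion of an axis point in the two directions of the frame at `P(s)`. -/
theorem exists_pt_add_axisPt {s t : OnePoint F} (h : s ≠ t) :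
    ∃ a b : F, b ≠ 0 ∧ ∀ y z c, pt s y z + c • axisPt t = pt s (y + c * a) (z + c * b) := by
  induction s using OnePoint.rec with
  | infty =>
    induction t using OnePoint.rec with
    | infty => exact absurd rfl h
    | coe t => exact ⟨-t, 1, one_ne_zero, fun y z c => by simp⟩
  | coe s =>
    induction t using OnePoint.rec with
    | infty =>
      refine ⟨0, 1, one_ne_zero, fun y z c => ?_⟩
      simp; ring
    | coe t =>
      have h' : s - t ≠ 0 := sub_ne_zero.2 fun e => h (by rw [e])
      refine ⟨1, s - t, h', fun y z c => ?_⟩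
      simp; constructor <;> ring

theorem mem_oscPlane_infty {x : V F} : x ∈ oscPlane F OnePoint.infty ↔ x 3 = 0 := by
  change _ * x 0 + _ * x 1 + _ * x 2 + _ * x 3 = 0 ↔ _
  simp

theorem mem_span_axisPt_pt {x : V F} {t s : OnePoint F} {y z : F} :
    x ∈ Submodule.span F {axisPt t, pt s y z} ↔ ∃ a b : F, a • axisPt t + b • pt s y z = x :=
  Submodule.mem_span_pair

theorem axisPt_smul_inj {t t' : OnePoint F} {c : F} (h : axisPt t = c • axisPt t') : t = t' := by
  induction t using OnePoint.rec <;> induction t' using OnePoint.rec <;>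
    simp at h ⊢
  · obtain ⟨h1, h2⟩ := h
    simp [← h2] at h1
  · obtain ⟨h1, h2⟩ := h
    rw [h1, ← h2, one_mul]

variable [CharP F 3]

variable (F) in
theorem three_eq_zero : (3 : F) = 0 := by exact_mod_cast CharP.cast_eq_zero F 3

theorem tangentVec_eq_axisPt (t : OnePoint F) : tangentVec t = axisPt t := by
  have h3 := three_eq_zero F
  induction t using OnePoint.rec with
  | infty => rfl
  | coe t =>
    change ![3 * t ^ 2, 2 * t, 1, 0] = _
    simp only [V_ext_iff, axisPt_coe]
    simp
    exact ⟨Or.inl h3, by linear_combination t * h3⟩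

theorem mem_oscPlane_coe {x : V F} {t : F} : x ∈ oscPlane F (t : OnePoint F) ↔
    x 0 = t ^ 3 * x 3 := by
  have h3 := three_eq_zero F
  change 1 * x 0 + (-3 * t) * x 1 + (3 * t ^ 2) * x 2 + (-t ^ 3) * x 3 = 0 ↔ _
  constructor
  · intro h; linear_combination h + (t * x 1 - t ^ 2 * x 2) * h3
  · intro h; linear_combination h - (t * x 1 - t ^ 2 * x 2) * h3

theorem mem_axis {x : V F} : x ∈ axis F ↔ x 0 = 0 ∧ x 3 = 0 := by
  rw [axis, Submodule.mem_iInf]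
  constructor
  · intro h
    have h1 := mem_oscPlane_infty.1 (h OnePoint.infty)
    have h2 := mem_oscPlane_coe.1 (h ((0 : F) : OnePoint F))
    exact ⟨by simpa using h2, h1⟩
  · rintro ⟨h0, h3⟩ t
    induction t using OnePoint.rec with
    | infty => exact mem_oscPlane_infty.2 h3
    | coe t => exact mem_oscPlane_coe.2 (by simp [h0, h3])

theorem axisPt_mem_axis (t : OnePoint F) : axisPt t ∈ axis F := by
  induction t using OnePoint.rec <;> simp [mem_axis]

theorem pt_notMem_axis (s : OnePoint F) (y z : F) : pt s y z ∉ axis F := by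
  induction s using OnePoint.rec <;> simp [mem_axis]

theorem exists_axisPt_of_mem_axis {x : V F} (hx : x ∈ axis F) (h0 : x ≠ 0) :
    ∃ (t : OnePoint F) (c : F), c ≠ 0 ∧ x = c • axisPt t := by
  obtain ⟨hx0, hx3⟩ := mem_axis.1 hx
  by_cases h2 : x 2 = 0
  · refine ⟨OnePoint.infty, x 1, fun h1 => h0 ?_, ?_⟩
    · exact V_ext_iff.2 ⟨hx0, h1, h2, hx3⟩
    · simp [V_ext_iff, hx0, hx3, h2]
  · refine ⟨((-x 1 / x 2 : F) : OnePoint F), x 2, h2, ?_⟩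
    simp [V_ext_iff, *]
    field_simp

theorem cube_inj {s t : F} (h : s ^ 3 = t ^ 3) : s = t :=
  frobenius_inj F 3 h

theorem pt_mem_oscPlane {s s' : OnePoint F} {y z : F} :
    pt s y z ∈ oscPlane F s' ↔ s = s' := by
  induction s using OnePoint.rec <;> induction s' using OnePoint.rec <;>
    simp [mem_oscPlane_infty, mem_oscPlane_coe]
  exact ⟨cube_inj, fun h => by rw [h]⟩

theorem smul_pt_inj {s s' : OnePoint F} {y z y' z' c : F} (h : pt s y z = c • pt s' y' z') :
    s = s' ∧ y = y' ∧ z = z' := by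
  obtain rfl : s = s' := by
    refine (pt_mem_oscPlane (y := y) (z := z)).1 ?_
    rw [h]
    exact Submodule.smul_mem _ _ (pt_mem_oscPlane.2 rfl)
  induction s using OnePoint.rec
  · simp at h
    obtain ⟨rfl, h⟩ := h
    simpa using h
  · simp at h
    obtain ⟨h0, h1, h2, rfl⟩ := h
    have hy : y = y' := by linear_combination h2
    subst hy
    exact ⟨rfl, rfl, by linear_combination h1⟩

theorem pt_inj {s s' : OnePoint F} {y z y' z' : F} :
    pt s y z = pt s' y' z' ↔ s = s' ∧ y = y' ∧ z = z' :=
  ⟨fun h => smul_pt_inj (c := 1) (by rw [h, one_smul]), by rintro ⟨rfl, rfl, rfl⟩; rfl⟩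

theorem exists_pt_of_notMem_axis [Finite F] {x : V F} (hx : x ∉ axis F) :
    ∃ (s : OnePoint F) (y z c : F), c ≠ 0 ∧ x = c • pt s y z := by
  by_cases h3 : x 3 = 0
  · have h0 : x 0 ≠ 0 := fun h0 => hx (mem_axis.2 ⟨h0, h3⟩)
    refine ⟨OnePoint.infty, x 1 / x 0, x 2 / x 0, x 0, h0, ?_⟩
    simp [V_ext_iff, h3]
    constructor <;> field_simp
  · obtain ⟨s, hs⟩ := Finite.surjective_of_injective (frobenius_inj F 3) (x 0 / x 3)
    replace hs : s ^ 3 = x 0 / x 3 := hs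
    refine ⟨(s : OnePoint F), x 2 / x 3 - s, x 1 / x 3 - s ^ 2 + s * (x 2 / x 3 - s), x 3, h3, ?_⟩
    simp [V_ext_iff, hs]
    refine ⟨?_, ?_, ?_⟩ <;> field_simp

/-- A line through `axisPt t` lies in the osculating plane of any of its points off the axis. -/
theorem pt_mem_span {t s s' : OnePoint F} {y z y' z' : F} :
    pt s' y' z' ∈ Submodule.span F {axisPt t, pt s y z} ↔
      s' = s ∧ ∃ c : F, pt s' y' z' = pt s y z + c • axisPt t := by
  rw [mem_span_axisPt_pt]
  constructor
  · rintro ⟨a, b, h⟩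
    have hs : s' = s := by
      refine (pt_mem_oscPlane (y := y') (z := z')).1 ?_
      rw [← h]
      refine Submodule.add_mem _ (Submodule.smul_mem _ _ ?_)
        (Submodule.smul_mem _ _ (pt_mem_oscPlane.2 rfl))
      exact (Submodule.mem_iInf _).1 (axisPt_mem_axis t) s
    subst hs
    have hb : b = 1 := by
      induction s' using OnePoint.rec <;> induction t using OnePoint.rec <;>
        simp at h <;> tauto
    subst hb
    exact ⟨rfl, a, by rw [← h, one_smul, add_comm]⟩
  · rintro ⟨-, c, h⟩
    exact ⟨c, 1, by rw [h, one_smul, add_comm]⟩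

theorem axisPt_mem_span {t t' s : OnePoint F} {y z : F} :
    axisPt t' ∈ Submodule.span F {axisPt t, pt s y z} ↔ t' = t := by
  rw [mem_span_axisPt_pt]
  constructor
  · rintro ⟨a, b, h⟩
    by_cases hb : b = 0
    · subst hb
      exact axisPt_smul_inj (c := a) (by rw [← h]; simp)
    · exfalso
      refine pt_notMem_axis s y z ?_
      have : b • pt s y z ∈ axis F := by
        rw [← add_sub_cancel_left (a • axisPt t) (b • pt s y z), h]
        exact Submodule.sub_mem _ (axisPt_mem_axis _)
          (Submodule.smul_mem _ _ (axisPt_mem_axis _))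
      exact (Submodule.smul_mem_iff _ hb).1 this
  · rintro rfl
    exact ⟨1, 0, by simp⟩

theorem isLine_span_axisPt_pt (t s : OnePoint F) (y z : F) :
    IsLine (Submodule.span F {axisPt t, pt s y z}) := by
  have : LinearIndependent F ![axisPt t, pt s y z] := by
    rw [LinearIndependent.pair_iff' (axisPt_ne_zero t)]
    intro a h
    exact pt_notMem_axis s y z (h ▸ Submodule.smul_mem _ _ (axisPt_mem_axis t))
  have h2 := finrank_span_eq_card this
  rw [Matrix.range_cons_cons_empty] at h2
  simpa [IsLine] using h2

/-- A two-dimensional space containing an axis point and a point off the axis is spanned by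
them. -/
theorem eq_span_axisPt_pt {ℓ : Submodule F (V F)} (hℓ : IsLine ℓ) {t s : OnePoint F} {y z : F}
    (h1 : axisPt t ∈ ℓ) (h2 : pt s y z ∈ ℓ) : ℓ = Submodule.span F {axisPt t, pt s y z} := by
  refine (Submodule.eq_of_le_of_finrank_eq ?_ ?_).symm
  · rw [Submodule.span_le]; rintro x (rfl | rfl) <;> assumption
  · rw [isLine_span_axisPt_pt, hℓ]

theorem isLine_axis : IsLine (axis F) := by
  have : axis F = Submodule.span F {![0, 1, 0, 0], ![0, 0, 1, 0]} := by
    ext x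
    rw [mem_axis, Submodule.mem_span_pair]
    constructor
    · rintro ⟨h0, h3⟩
      exact ⟨x 1, x 2, by simp [V_ext_iff, h0, h3]⟩
    · rintro ⟨a, b, rfl⟩; simp
  have hli : LinearIndependent F ![(![0, 1, 0, 0] : V F), ![0, 0, 1, 0]] := by
    rw [LinearIndependent.pair_iff]
    intro a b h
    simpa [V_ext_iff] using h
  have h2 := finrank_span_eq_card hli
  rw [Matrix.range_cons_cons_empty] at h2
  rw [IsLine, this]
  simpa using h2

end Coordinates

/-! ### Points, lines and planes in these coordinates -/

section Incidence

variable {F : Type*} [Field F]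

theorem onSub_mk {v : V F} {hv : v ≠ 0} {W : Submodule F (V F)} :
    OnSub (Projectivization.mk F v hv) W ↔ v ∈ W := by
  rw [OnSub, Projectivization.submodule_mk, Submodule.span_singleton_le_iff_mem]

theorem isExternal_iff {ℓ : Submodule F (V F)} :
    IsExternal ℓ ↔ IsLine ℓ ∧ ∀ t, vec t ∉ ℓ := by
  refine and_congr_right fun _ => ⟨fun h t ht => h _ ⟨t, rfl⟩ (onSub_mk.2 ht), ?_⟩
  rintro h _ ⟨t, rfl⟩ ht
  exact h t (onSub_mk.1 ht)

variable [CharP F 3]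

theorem mk_pt_mem_cubic {s : OnePoint F} {y z : F} :
    Projectivization.mk F (pt s y z) (pt_ne_zero s y z) ∈ cubic F ↔ y = 0 ∧ z = 0 := by
  constructor
  · rintro ⟨t, ht⟩
    obtain ⟨c, hc⟩ := (Projectivization.mk_eq_mk_iff' F _ _ _ _).1 ht
    rw [vec_eq_pt] at hc
    obtain ⟨-, h⟩ := smul_pt_inj hc.symm
    exact ⟨h.1.symm, h.2.symm⟩
  · rintro ⟨rfl, rfl⟩
    exact ⟨s, by simp [vec_eq_pt]⟩

theorem mem_tangent_pt {t s : OnePoint F} {y z : F} :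
    pt s y z ∈ Submodule.span F {vec t, tangentVec t} ↔ s = t ∧ z = 0 := by
  rw [Set.pair_comm, tangentVec_eq_axisPt, vec_eq_pt, pt_mem_span]
  simp only [pt_add_axisPt_self, pt_inj]
  constructor
  · rintro ⟨rfl, c, -, -, rfl⟩; exact ⟨rfl, rfl⟩
  · rintro ⟨rfl, rfl⟩; exact ⟨rfl, y, rfl, by simp, rfl⟩

theorem oscPlane_injective : Function.Injective (oscPlane F) := fun s _ h =>
  (pt_mem_oscPlane (y := 0) (z := 0)).1 (h ▸ pt_mem_oscPlane.2 (rfl : s = s))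

/-- In characteristic `3` the points on exactly one osculating plane are those off the axis, so
that the `TO`-points are the points `z = 0`, `y ≠ 0` in the frame coordinates. -/
theorem mem_TOPoints_iff [Finite F] {p : ℙ F (V F)} :
    p ∈ TOPoints F ↔
      ∃ s b, b ≠ 0 ∧ p = Projectivization.mk F (pt s b 0) (pt_ne_zero s b 0) := by
  constructor
  · induction p using Projectivization.ind with | h v hv =>
    rintro ⟨hc, ⟨ℓ, ⟨t, rfl⟩, hℓ⟩, π, -, hu⟩
    rw [onSub_mk] at hℓ
    have hax : v ∉ axis F := by
      intro h
      have h' := (Submodule.mem_iInf _).1 h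
      have e1 := hu _ ⟨⟨OnePoint.infty, rfl⟩, onSub_mk.2 (h' _)⟩
      have e2 := hu _ ⟨⟨((0 : F) : OnePoint F), rfl⟩, onSub_mk.2 (h' _)⟩
      exact OnePoint.infty_ne_coe _ (oscPlane_injective (e1.trans e2.symm))
    obtain ⟨s, y, z, c, hc0, rfl⟩ := exists_pt_of_notMem_axis hax
    obtain ⟨rfl, rfl⟩ := mem_tangent_pt.1 ((Submodule.smul_mem_iff _ hc0).1 hℓ)
    have hmk : Projectivization.mk F (c • pt s y 0) hv =
        Projectivization.mk F (pt s y 0) (pt_ne_zero s y 0) :=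
      (Projectivization.mk_eq_mk_iff' F _ _ _ _).2 ⟨c, rfl⟩
    refine ⟨s, y, fun hy => hc ?_, hmk⟩
    rw [hmk]
    exact mk_pt_mem_cubic.2 ⟨hy, rfl⟩
  · rintro ⟨s, b, hb, rfl⟩
    refine ⟨fun h => hb (mk_pt_mem_cubic.1 h).1,
      ⟨_, ⟨s, rfl⟩, onSub_mk.2 (mem_tangent_pt.2 ⟨rfl, rfl⟩)⟩,
      oscPlane F s, ⟨⟨s, rfl⟩, onSub_mk.2 (pt_mem_oscPlane.2 rfl)⟩, ?_⟩
    rintro _ ⟨⟨s', rfl⟩, h⟩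
    rw [pt_mem_oscPlane.1 (onSub_mk.1 h)]

theorem mk_pt_inj {s s' : OnePoint F} {y z y' z' : F} :
    Projectivization.mk F (pt s y z) (pt_ne_zero s y z) =
      Projectivization.mk F (pt s' y' z') (pt_ne_zero s' y' z') ↔ s = s' ∧ y = y' ∧ z = z' := by
  rw [Projectivization.mk_eq_mk_iff']
  constructor
  · rintro ⟨a, h⟩; exact smul_pt_inj h.symm
  · rintro ⟨rfl, rfl, rfl⟩; exact ⟨1, one_smul _ _⟩

end Incidence

/-! ### The group of the twisted cubic -/

section Group

variable {F : Type*} [Field F]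

/-- The linear map `g` permutes the points `axisPt t` of the axis as `σ` permutes the parameters,
and carries the frame of the osculating plane at `P(s)` to that of `P(σ s)` by an affine map which
preserves the tangent `z = 0` and its point `P(s)`, and which multiplies `z` by a square. -/
structure ActsBy (g : V F ≃ₗ[F] V F) (σ : Equiv.Perm (OnePoint F)) : Prop where
  map_axisPt : ∀ t, ∃ c : F, c ≠ 0 ∧ g (axisPt t) = c • axisPt (σ t)
  map_pt : ∀ s, ∃ c e f d : F, c ≠ 0 ∧ e ≠ 0 ∧ d ≠ 0 ∧
    ∀ y z, g (pt s y z) = c • pt (σ s) (e * y + f * z) (d ^ 2 * z)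

namespace ActsBy

variable {g h : V F ≃ₗ[F] V F} {σ τ : Equiv.Perm (OnePoint F)}

theorem mul (hg : ActsBy g σ) (hh : ActsBy h τ) : ActsBy (g * h) (σ * τ) where
  map_axisPt t := by
    obtain ⟨c, hc, h1⟩ := hh.map_axisPt t
    obtain ⟨c', hc', h2⟩ := hg.map_axisPt (τ t)
    refine ⟨c * c', mul_ne_zero hc hc', ?_⟩
    rw [LinearEquiv.mul_apply, h1, map_smul, h2, smul_smul, Equiv.Perm.mul_apply]
  map_pt s := by
    obtain ⟨c, e, f, d, hc, he, hd, h1⟩ := hh.map_pt s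
    obtain ⟨c', e', f', d', hc', he', hd', h2⟩ := hg.map_pt (τ s)
    refine ⟨c * c', e' * e, e' * f + f' * d ^ 2, d' * d, mul_ne_zero hc hc', mul_ne_zero he' he,
      mul_ne_zero hd' hd, fun y z => ?_⟩
    rw [LinearEquiv.mul_apply, h1, map_smul, h2, smul_smul, Equiv.Perm.mul_apply]
    congr 2 <;> ring

theorem inv (hg : ActsBy g σ) : ActsBy g⁻¹ σ⁻¹ where
  map_axisPt t := by
    obtain ⟨c, hc, h1⟩ := hg.map_axisPt (σ⁻¹ t)
    refine ⟨c⁻¹, inv_ne_zero hc, ?_⟩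
    rw [show σ (σ⁻¹ t) = t from σ.apply_symm_apply t] at h1
    refine g.symm_apply_eq.2 ?_
    rw [map_smul, h1, inv_smul_smul₀ hc]
  map_pt s := by
    obtain ⟨c, e, f, d, hc, he, hd, h1⟩ := hg.map_pt (σ⁻¹ s)
    refine ⟨c⁻¹, e⁻¹, -(e⁻¹ * f * (d⁻¹) ^ 2), d⁻¹, inv_ne_zero hc, inv_ne_zero he,
      inv_ne_zero hd, fun y z => ?_⟩
    rw [show σ (σ⁻¹ s) = s from σ.apply_symm_apply s] at h1
    refine g.symm_apply_eq.2 ?_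
    rw [map_smul, h1, inv_smul_smul₀ hc]
    congr 1 <;> field_simp
    ring

theorem of_eq_smul (hg : ActsBy g σ) {a : F} (ha : a ≠ 0) (hh : ∀ x, h x = a • g x) :
    ActsBy h σ where
  map_axisPt t := by
    obtain ⟨c, hc, h1⟩ := hg.map_axisPt t
    exact ⟨a * c, mul_ne_zero ha hc, by rw [hh, h1, smul_smul]⟩
  map_pt s := by
    obtain ⟨c, e, f, d, hc, he, hd, h1⟩ := hg.map_pt s
    exact ⟨a * c, e, f, d, mul_ne_zero ha hc, he, hd, fun y z => by rw [hh, h1, smul_smul]⟩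

theorem map_vec (hg : ActsBy g σ) (s : OnePoint F) :
    ∃ c : F, c ≠ 0 ∧ g (vec s) = c • vec (σ s) := by
  obtain ⟨c, e, f, d, hc, -, -, h⟩ := hg.map_pt s
  exact ⟨c, hc, by rw [vec_eq_pt, h, vec_eq_pt]; simp⟩

theorem smul_cubic (hg : ActsBy g σ) : g • cubic F ⊆ cubic F := by
  rintro _ ⟨_, ⟨s, rfl⟩, rfl⟩
  obtain ⟨c, hc, h⟩ := hg.map_vec s
  refine ⟨σ s, ?_⟩
  change _ = g • _
  rw [Projectivization.smul_mk, Projectivization.mk_eq_mk_iff']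
  exact ⟨c⁻¹, by rw [LinearEquiv.smul_def, h, inv_smul_smul₀ hc]⟩

theorem mem_G (hg : ActsBy g σ) : g ∈ G F := by
  refine MulAction.mem_stabilizer_iff.2 (hg.smul_cubic.antisymm ?_)
  rw [Set.subset_smul_set_iff]
  exact hg.inv.smul_cubic

end ActsBy

theorem exists_map_vec_of_mem_G {g : V F ≃ₗ[F] V F} (hg : g ∈ G F) (s : OnePoint F) :
    ∃ (r : OnePoint F) (c : F), c ≠ 0 ∧ g (vec s) = c • vec r := by
  have h : g • Projectivization.mk F (vec s) (vec_ne_zero s) ∈ cubic F := by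
    rw [← MulAction.mem_stabilizer_iff.1 hg]
    exact Set.smul_mem_smul_set ⟨s, rfl⟩
  obtain ⟨r, hr⟩ := h
  rw [Projectivization.smul_mk, eq_comm, Projectivization.mk_eq_mk_iff'] at hr
  obtain ⟨c, hc⟩ := hr
  refine ⟨r, c, ?_, hc.symm⟩
  rintro rfl
  rw [zero_smul] at hc
  exact vec_ne_zero s (g.map_eq_zero_iff.1 hc.symm)

/-- The projectivity induced by `t ↦ k t`. -/
def scale (k : Fˣ) : V F ≃ₗ[F] V F where
  toFun x := ![k ^ 3 * x 0, k ^ 2 * x 1, k * x 2, x 3]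
  invFun x := ![(k⁻¹ : Fˣ) ^ 3 * x 0, (k⁻¹ : Fˣ) ^ 2 * x 1, (k⁻¹ : Fˣ) * x 2, x 3]
  map_add' x y := by simp [mul_add]
  map_smul' c x := by simp [mul_left_comm]
  left_inv x := by simp [V_ext_iff]
  right_inv x := by simp [V_ext_iff]

/-- The projectivity induced by `t ↦ 1 / t`. -/
def reverse : V F ≃ₗ[F] V F where
  toFun x := ![x 3, x 2, x 1, x 0]
  invFun x := ![x 3, x 2, x 1, x 0]
  map_add' x y := by simp
  map_smul' c x := by simp
  left_inv x := by simp [V_ext_iff]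
  right_inv x := by simp [V_ext_iff]

/-- The projectivity induced by `t ↦ t + β`. -/
def translate (β : F) : V F ≃ₗ[F] V F where
  toFun x := ![x 0 + 3 * β * x 1 + 3 * β ^ 2 * x 2 + β ^ 3 * x 3,
    x 1 + 2 * β * x 2 + β ^ 2 * x 3, x 2 + β * x 3, x 3]
  invFun x := ![x 0 - 3 * β * x 1 + 3 * β ^ 2 * x 2 - β ^ 3 * x 3,
    x 1 - 2 * β * x 2 + β ^ 2 * x 3, x 2 - β * x 3, x 3]
  map_add' x y := by simp; refine ⟨?_, ?_, ?_⟩ <;> ring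
  map_smul' c x := by simp; refine ⟨?_, ?_, ?_⟩ <;> ring
  left_inv x := by simp [V_ext_iff]; constructor <;> ring
  right_inv x := by simp [V_ext_iff]; constructor <;> ring

theorem scale_apply (k : Fˣ) (x : V F) :
    scale k x = ![k ^ 3 * x 0, k ^ 2 * x 1, k * x 2, x 3] := rfl

theorem reverse_apply (x : V F) : reverse x = ![x 3, x 2, x 1, x 0] := rfl

open Classical in
/-- The permutation `t ↦ 1 / t` of the projective line. -/
noncomputable def recipPerm (F : Type*) [Field F] : Equiv.Perm (OnePoint F) :=
  Function.Involutive.toPerm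
    (fun t => t.elim ((0 : F) : OnePoint F)
      fun s => if s = 0 then OnePoint.infty else ((s⁻¹ : F) : OnePoint F)) (by
    intro t
    induction t using OnePoint.rec with
    | infty => simp
    | coe t => by_cases h : t = 0 <;> simp [h])

@[simp] theorem recipPerm_infty : recipPerm F OnePoint.infty = ((0 : F) : OnePoint F) := rfl

@[simp] theorem recipPerm_zero : recipPerm F ((0 : F) : OnePoint F) = OnePoint.infty := if_pos rfl

theorem recipPerm_coe {t : F} (ht : t ≠ 0) :
    recipPerm F (t : OnePoint F) = ((t⁻¹ : F) : OnePoint F) := if_neg ht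

/-- The permutation of the projective line that fixes `∞` and extends a permutation of `F`. -/
def affPerm {F : Type*} (e : Equiv.Perm F) : Equiv.Perm (OnePoint F) := Equiv.optionCongr e

@[simp] theorem affPerm_infty {F : Type*} (e : Equiv.Perm F) :
    affPerm e OnePoint.infty = OnePoint.infty := rfl

@[simp] theorem affPerm_coe {F : Type*} (e : Equiv.Perm F) (t : F) :
    affPerm e (t : OnePoint F) = ((e t : F) : OnePoint F) := rfl

theorem scale_actsBy (k : Fˣ) : ActsBy (scale k) (affPerm (Equiv.mulLeft₀ (k : F) k.ne_zero)) where
  map_axisPt t := by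
    induction t using OnePoint.rec with
    | infty => exact ⟨k ^ 2, by simp, by simp [scale_apply]⟩
    | coe t => refine ⟨k, by simp, by simp [scale_apply]; ring⟩
  map_pt s := by
    have hk := k.ne_zero
    induction s using OnePoint.rec with
    | infty =>
      refine ⟨k ^ 3, (k : F)⁻¹, 0, (k : F)⁻¹, by simp, by simp, by simp, fun y z => ?_⟩
      simp [scale_apply]
      constructor <;> field_simp
    | coe s =>
      refine ⟨1, k, 0, k, one_ne_zero, hk, hk, fun y z => ?_⟩
      simp [scale_apply]
      refine ⟨?_, ?_, ?_⟩ <;> ring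

theorem reverse_actsBy : ActsBy (reverse (F := F)) (recipPerm F) where
  map_axisPt t := by
    induction t using OnePoint.rec with
    | infty => exact ⟨1, one_ne_zero, by simp [reverse_apply]⟩
    | coe t =>
      by_cases ht : t = 0
      · subst ht
        exact ⟨1, one_ne_zero, by simp [reverse_apply]⟩
      · refine ⟨-t, neg_ne_zero.2 ht, ?_⟩
        simp [reverse_apply, recipPerm_coe ht, ht]
  map_pt s := by
    induction s using OnePoint.rec with
    | infty =>
      refine ⟨1, 1, 0, 1, one_ne_zero, one_ne_zero, one_ne_zero, fun y z => ?_⟩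
      simp [reverse_apply]
    | coe s =>
      by_cases hs : s = 0
      · subst hs
        refine ⟨1, 1, 0, 1, one_ne_zero, one_ne_zero, one_ne_zero, fun y z => ?_⟩
        simp [reverse_apply]
      · refine ⟨s ^ 3, -(s ^ 2)⁻¹, (s ^ 3)⁻¹, (s ^ 2)⁻¹, by simpa, by simpa, by simpa,
          fun y z => ?_⟩
        simp [reverse_apply, recipPerm_coe hs]
        refine ⟨?_, ?_, ?_⟩ <;> field_simp <;> ring

/-- A polynomial function of degree at most `5` that vanishes identically on a field with more than
five elements has zero coefficients. -/
theorem coeff_eq_zero_of_forall_eval [Finite F] (hF : 5 < Nat.card F) {a : Fin 6 → F}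
    (h : ∀ t : F, ∑ i, a i * t ^ (i : ℕ) = 0) (i : Fin 6) : a i = 0 := by
  classical
  have := Fintype.ofFinite F
  let p : Polynomial F := ∑ i : Fin 6, Polynomial.monomial (i : ℕ) (a i)
  have hp : p = 0 := by
    refine Polynomial.eq_zero_of_natDegree_lt_card_of_eval_eq_zero' p Finset.univ (fun t _ => ?_) ?_
    · simpa [p, Polynomial.eval_finsetSum] using h t
    · refine lt_of_le_of_lt (b := 5) ?_ (by simpa [Nat.card_eq_fintype_card] using hF)
      exact Polynomial.natDegree_sum_le_of_forall_le _ _ fun i _ =>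
        (Polynomial.natDegree_monomial_le _).trans (by omega)
  have h2 : p.coeff i = a i := by
    simp only [p, Polynomial.finsetSum_coeff, Polynomial.coeff_monomial, Fin.val_inj]
    simp
  rw [← h2, hp, Polynomial.coeff_zero]

variable [CharP F 3]

theorem translate_apply (β : F) (x : V F) :
    translate β x = ![x 0 + β ^ 3 * x 3, x 1 - β * x 2 + β ^ 2 * x 3, x 2 + β * x 3, x 3] := by
  have h3 := three_eq_zero F
  have : translate β x = ![x 0 + 3 * β * x 1 + 3 * β ^ 2 * x 2 + β ^ 3 * x 3,
    x 1 + 2 * β * x 2 + β ^ 2 * x 3, x 2 + β * x 3, x 3] := rfl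
  rw [this]
  simp [h3]
  linear_combination β * x 2 * h3

theorem translate_actsBy (β : F) : ActsBy (translate β) (affPerm (Equiv.addRight β)) where
  map_axisPt t := by
    refine ⟨1, one_ne_zero, ?_⟩
    induction t using OnePoint.rec with
    | infty => simp [translate_apply]
    | coe t => simp [translate_apply]; ring
  map_pt s := by
    have h3 := three_eq_zero F
    induction s using OnePoint.rec with
    | infty =>
      refine ⟨1, 1, -β, 1, one_ne_zero, one_ne_zero, one_ne_zero, fun y z => ?_⟩
      simp [translate_apply]
      ring
    | coe s =>
      refine ⟨1, 1, 0, 1, one_ne_zero, one_ne_zero, one_ne_zero, fun y z => ?_⟩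
      simp [translate_apply]
      refine ⟨?_, ?_, by ring⟩
      · linear_combination (-(s ^ 2 * β + s * β ^ 2)) * h3
      · linear_combination (-(s * β)) * h3

/-- `G` is doubly transitive on the points of the cubic. -/
theorem exists_actsBy_two_points {s r : OnePoint F} (h : s ≠ r) :
    ∃ (g : V F ≃ₗ[F] V F) (σ : Equiv.Perm (OnePoint F)), ActsBy g σ ∧
      σ s = OnePoint.infty ∧ σ r = ((0 : F) : OnePoint F) := by
  have key : ∀ r : OnePoint F, OnePoint.infty ≠ r →
      ∃ (g : V F ≃ₗ[F] V F) (σ : Equiv.Perm (OnePoint F)), ActsBy g σ ∧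
      σ OnePoint.infty = OnePoint.infty ∧ σ r = ((0 : F) : OnePoint F) := by
    intro r hr
    induction r using OnePoint.rec with
    | infty => exact absurd rfl hr
    | coe r => exact ⟨_, _, translate_actsBy (-r), by simp, by simp⟩
  induction s using OnePoint.rec with
  | infty => exact key r h
  | coe s =>
    have h1 := reverse_actsBy.mul (translate_actsBy (-s))
    set ρ := recipPerm F * affPerm (Equiv.addRight (-s)) with hρ
    have hs : ρ (s : OnePoint F) = OnePoint.infty := by simp [hρ]
    obtain ⟨g, σ, hg, e1, e2⟩ := key (ρ r) fun e => h (ρ.injective (hs.trans e))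
    exact ⟨_, _, hg.mul h1, by simp [hs, e1], by simp [e2]⟩

omit [CharP F 3] in
/-- A collineation of the cubic fixing `P(∞)` and `P(0)` is induced by some `t ↦ k t`: the
equations of the cubic, applied to the image of `P(t)`, are polynomial identities in `t`. -/
theorem exists_eq_smul_scale [Finite F] (hF : 5 < Nat.card F) {g : V F ≃ₗ[F] V F} (hg : g ∈ G F)
    {a d : F} (ha : a ≠ 0) (hd : d ≠ 0) (h0 : g ![1, 0, 0, 0] = a • ![1, 0, 0, 0])
    (h3 : g ![0, 0, 0, 1] = d • ![0, 0, 0, 1]) :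
    ∃ k : Fˣ, ∀ x, g x = d • scale k x := by
  obtain ⟨u, hu⟩ : ∃ u, u = g ![0, 1, 0, 0] := ⟨_, rfl⟩
  obtain ⟨w, hw⟩ : ∃ w, w = g ![0, 0, 1, 0] := ⟨_, rfl⟩
  have hgx : ∀ x, g x = ![a * x 0 + u 0 * x 1 + w 0 * x 2, u 1 * x 1 + w 1 * x 2,
      u 2 * x 1 + w 2 * x 2, u 3 * x 1 + w 3 * x 2 + d * x 3] := by
    intro x
    have hx : x = x 0 • ![1, 0, 0, 0] + x 1 • ![0, 1, 0, 0] + x 2 • ![0, 0, 1, 0]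
        + x 3 • ![0, 0, 0, 1] := by simp [V_ext_iff]
    conv_lhs => rw [hx]
    simp only [map_add, map_smul, h0, h3, ← hu, ← hw]
    refine V_ext_iff.2 ⟨?_, ?_, ?_, ?_⟩ <;>
      simp only [Pi.add_apply, Pi.smul_apply, smul_eq_mul] <;> simp <;> ring
  -- the images of `P(t)` satisfy `x₀ x₂ = x₁²` and `x₁ x₃ = x₂²`
  have hquad : ∀ t : F, (a * t ^ 3 + u 0 * t ^ 2 + w 0 * t) * (u 2 * t ^ 2 + w 2 * t)
        = (u 1 * t ^ 2 + w 1 * t) ^ 2 ∧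
      (u 1 * t ^ 2 + w 1 * t) * (u 3 * t ^ 2 + w 3 * t + d) = (u 2 * t ^ 2 + w 2 * t) ^ 2 := by
    intro t
    obtain ⟨r, c, -, hr⟩ := exists_map_vec_of_mem_G hg (t : OnePoint F)
    rw [hgx] at hr
    induction r using OnePoint.rec with
    | infty =>
      simp at hr
      obtain ⟨-, e1, e2, e3⟩ := hr
      rw [e1, e2, e3]; simp
    | coe r =>
      simp at hr
      obtain ⟨e0, e1, e2, e3⟩ := hr
      rw [e0, e1, e2, e3]; constructor <;> ring
  have hA := coeff_eq_zero_of_forall_eval hF (a := ![0, 0, w 0 * w 2 - w 1 ^ 2,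
    u 0 * w 2 + w 0 * u 2 - 2 * u 1 * w 1, a * w 2 + u 0 * u 2 - u 1 ^ 2, a * u 2])
    (fun t => by simp [Fin.sum_univ_succ]; linear_combination (hquad t).1)
  have hB := coeff_eq_zero_of_forall_eval hF (a := ![0, w 1 * d,
    u 1 * d + w 1 * w 3 - w 2 ^ 2, u 1 * w 3 + w 1 * u 3 - 2 * u 2 * w 2,
    u 1 * u 3 - u 2 ^ 2, 0])
    (fun t => by simp [Fin.sum_univ_succ]; linear_combination (hquad t).2)
  have u2 : u 2 = 0 := by simpa [ha] using hA 5
  have w1 : w 1 = 0 := by simpa [hd] using hB 1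
  have eA4 : a * w 2 = u 1 ^ 2 := by simpa [u2, sub_eq_zero] using hA 4
  have eA3 : u 0 * w 2 = 0 := by simpa [u2, w1] using hA 3
  have eA2 : w 0 * w 2 = 0 := by simpa [w1] using hA 2
  have eB2 : u 1 * d = w 2 ^ 2 := by simpa [w1, sub_eq_zero] using hB 2
  have eB3 : u 1 * w 3 = 0 := by simpa [u2, w1] using hB 3
  have eB4 : u 1 * u 3 = 0 := by simpa [u2] using hB 4
  -- otherwise the image of `g` would lie in the plane `x₁ = 0`
  have w2 : w 2 ≠ 0 := by
    intro w2
    have u1 : u 1 = 0 := by simpa [w2, hd] using eB2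
    obtain ⟨x, hx⟩ := g.surjective ![0, 1, 0, 0]
    rw [hgx] at hx
    simp [u1, w1] at hx
  have u1 : u 1 ≠ 0 := by
    intro u1
    rw [u1] at eB2
    exact w2 (by simpa using eB2.symm)
  have hk : w 2 / d ≠ 0 := div_ne_zero w2 hd
  refine ⟨Units.mk0 _ hk, fun x => ?_⟩
  have e1 : u 1 = d * (w 2 / d) ^ 2 := by
    field_simp; linear_combination eB2
  have e0 : a = d * (w 2 / d) ^ 3 := by
    refine mul_right_cancel₀ w2 ?_
    rw [eA4, e1]; field_simp
  have u0 : u 0 = 0 := by simpa [w2] using eA3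
  have w0 : w 0 = 0 := by simpa [w2] using eA2
  have u3 : u 3 = 0 := by simpa [u1] using eB4
  have w3 : w 3 = 0 := by simpa [u1] using eB3
  have e2 : w 2 = d * (w 2 / d) := by field_simp
  rw [hgx, scale_apply]
  simp [u0, w0, u3, w3, u2, w1]
  refine ⟨?_, ?_, ?_⟩
  · rw [← mul_assoc, ← e0]
  · rw [← mul_assoc, ← e1]
  · rw [← mul_assoc, ← e2]

/-- The elements of `G` permute the frames of the osculating planes. -/
theorem exists_actsBy_of_mem_G [Finite F] (hF : 5 < Nat.card F) {g : V F ≃ₗ[F] V F}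
    (hg : g ∈ G F) : ∃ σ, ActsBy g σ := by
  obtain ⟨s, c, hc, hs⟩ := exists_map_vec_of_mem_G hg OnePoint.infty
  obtain ⟨r, d, hd, hr⟩ := exists_map_vec_of_mem_G hg ((0 : F) : OnePoint F)
  have hsr : s ≠ r := by
    rintro rfl
    have h1 : g (d • vec OnePoint.infty - c • vec ((0 : F) : OnePoint F)) = 0 := by
      rw [map_sub, map_smul, map_smul, hs, hr, smul_comm, sub_self]
    rw [g.map_eq_zero_iff] at h1
    simp [hc] at h1
  obtain ⟨h, σ, hh, e1, e2⟩ := exists_actsBy_two_points hsr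
  obtain ⟨c', hc', hs'⟩ := hh.map_vec s
  obtain ⟨d', hd', hr'⟩ := hh.map_vec r
  have h0 : (h * g) ![1, 0, 0, 0] = (c * c') • ![1, 0, 0, 0] := by
    rw [← vec_infty, LinearEquiv.mul_apply, hs, map_smul, hs', smul_smul, e1]
  have h3 : (h * g) ![0, 0, 0, 1] = (d * d') • ![0, 0, 0, 1] := by
    rw [show (![0, 0, 0, 1] : V F) = vec ((0 : F) : OnePoint F) by simp, LinearEquiv.mul_apply, hr,
      map_smul, hr', smul_smul, e2]
  obtain ⟨k, hk⟩ := exists_eq_smul_scale hF (mul_mem hh.mem_G hg) (mul_ne_zero hc hc')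
    (mul_ne_zero hd hd') h0 h3
  have := hh.inv.mul ((scale_actsBy k).of_eq_smul (mul_ne_zero hd hd') hk)
  rw [inv_mul_cancel_left] at this
  exact ⟨_, this⟩

end Group

/-! ### The lines meeting the axis -/

section EALines

variable {F : Type*} [Field F]

instance [Finite F] : Finite (OnePoint F) := inferInstanceAs (Finite (Option F))

theorem card_onePoint (F : Type*) [Finite F] : Nat.card (OnePoint F) = Nat.card F + 1 :=
  Finite.card_option

/-- The line joining the point `axisPt t` of the axis to the point `pt s y z`. -/
def eaLine (t s : OnePoint F) (y z : F) : Submodule F (V F) :=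
  Submodule.span F {axisPt t, pt s y z}

theorem isLine_smul {g : V F ≃ₗ[F] V F} {ℓ : Submodule F (V F)} (h : IsLine ℓ) :
    IsLine (g • ℓ) :=
  (LinearEquiv.finrank_map_eq g ℓ).trans h

theorem mem_smul_of_apply_eq_smul {g : V F ≃ₗ[F] V F} {ℓ : Submodule F (V F)} {v w : V F} {c : F}
    (hc : c ≠ 0) (hv : v ∈ ℓ) (h : g v = c • w) : w ∈ g • ℓ := by
  refine (Submodule.smul_mem_iff _ hc).1 ?_
  rw [← h]
  exact ⟨v, hv, rfl⟩

theorem axisPt_mem_eaLine (t s : OnePoint F) (y z : F) : axisPt t ∈ eaLine t s y z :=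
  Submodule.subset_span (by simp)

theorem pt_mem_eaLine (t s : OnePoint F) (y z : F) : pt s y z ∈ eaLine t s y z :=
  Submodule.subset_span (by simp)

theorem isLineOrbit_of {O : Set (Submodule F (V F))} {ℓ : Submodule F (V F)} (hℓ : IsLine ℓ)
    (hO : ℓ ∈ O) (h1 : ∀ g ∈ G F, ∀ m ∈ O, g • m ∈ O) (h2 : ∀ m ∈ O, ∃ g ∈ G F, g • m = ℓ) :
    IsLineOrbit O := by
  refine ⟨ℓ, hℓ, Set.Subset.antisymm (fun m hm => ?_) ?_⟩
  · obtain ⟨g, hg, rfl⟩ := h2 m hm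
    exact ⟨⟨g, hg⟩⁻¹, inv_smul_smul g m⟩
  · rintro _ ⟨g, rfl⟩
    exact h1 g g.2 ℓ hO

variable [CharP F 3]

theorem isLine_eaLine (t s : OnePoint F) (y z : F) : IsLine (eaLine t s y z) :=
  isLine_span_axisPt_pt t s y z

theorem eaLine_add (t s : OnePoint F) (y z c : F) {y' z' : F}
    (h : pt s y z + c • axisPt t = pt s y' z') : eaLine t s y z = eaLine t s y' z' :=
  eq_span_axisPt_pt (isLine_eaLine _ _ _ _) (axisPt_mem_eaLine _ _ _ _) (pt_mem_span.2
    ⟨rfl, c, h.symm⟩)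

theorem eaLine_self (s : OnePoint F) (y z : F) : eaLine s s y z = eaLine s s 0 z :=
  eaLine_add s s y z (-y) (by rw [pt_add_axisPt_self, add_neg_cancel])

theorem ActsBy.smul_eaLine {g : V F ≃ₗ[F] V F} {σ : Equiv.Perm (OnePoint F)} (hg : ActsBy g σ)
    (s : OnePoint F) : ∃ e f d : F, e ≠ 0 ∧ d ≠ 0 ∧ ∀ t y z,
      g • eaLine t s y z = eaLine (σ t) (σ s) (e * y + f * z) (d ^ 2 * z) := by
  obtain ⟨c, e, f, d, hc, he, hd, h⟩ := hg.map_pt s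
  refine ⟨e, f, d, he, hd, fun t y z => ?_⟩
  obtain ⟨c', hc', h'⟩ := hg.map_axisPt t
  exact eq_span_axisPt_pt (isLine_smul (isLine_eaLine _ _ _ _))
    (mem_smul_of_apply_eq_smul hc' (axisPt_mem_eaLine _ _ _ _) h')
    (mem_smul_of_apply_eq_smul hc (pt_mem_eaLine _ _ _ _) (h y z))

/-- The lines joining a `TO`-point `pt s b 0`, `b ≠ 0`, to a point of the axis not on the tangent
through the `TO`-point. -/
def transversalLines (F : Type*) [Field F] : Set (Submodule F (V F)) :=
  {ℓ | ∃ s t b, s ≠ t ∧ b ≠ 0 ∧ ℓ = eaLine t s b 0}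

/-- The lines in an osculating plane which meet the tangent of that plane in its point on the axis
and whose invariant, the coordinate `z` of its points off the axis, is `c` times a nonzero
square. -/
def concurrentLines (c : F) : Set (Submodule F (V F)) :=
  {ℓ | ∃ s d, d ≠ 0 ∧ ℓ = eaLine s s 0 (d ^ 2 * c)}

theorem transversalLines_subset : transversalLines F ⊆ EALines F := by
  rintro _ ⟨s, t, b, hst, hb, rfl⟩
  refine ⟨isExternal_iff.2 ⟨isLine_eaLine _ _ _ _, fun r hr => ?_⟩, ?_, ?_⟩
  · rw [vec_eq_pt] at hr
    obtain ⟨rfl, c, hc⟩ := pt_mem_span.1 hr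
    obtain ⟨a, d, hd, h⟩ := exists_pt_add_axisPt hst
    rw [h, pt_inj] at hc
    obtain ⟨-, h1, h2⟩ := hc
    obtain rfl : c = 0 := by simpa [hd] using h2
    exact hb (by simpa using h1.symm)
  · intro h
    exact pt_notMem_axis s b 0 (h ▸ pt_mem_eaLine t s b 0)
  · exact ⟨Projectivization.mk F _ (axisPt_ne_zero t), onSub_mk.2 (axisPt_mem_eaLine _ _ _ _),
      onSub_mk.2 (axisPt_mem_axis t)⟩

theorem concurrentLines_subset {c : F} (hc : c ≠ 0) : concurrentLines c ⊆ EALines F := by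
  rintro _ ⟨s, d, hd, rfl⟩
  refine ⟨isExternal_iff.2 ⟨isLine_eaLine _ _ _ _, fun r hr => ?_⟩, ?_, ?_⟩
  · rw [vec_eq_pt] at hr
    obtain ⟨rfl, a, ha⟩ := pt_mem_span.1 hr
    rw [pt_add_axisPt_self, pt_inj] at ha
    exact mul_ne_zero (pow_ne_zero 2 hd) hc ha.2.2.symm
  · intro h
    exact pt_notMem_axis s 0 _ (h ▸ pt_mem_eaLine s s 0 _)
  · exact ⟨Projectivization.mk F _ (axisPt_ne_zero s), onSub_mk.2 (axisPt_mem_eaLine _ _ _ _),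
      onSub_mk.2 (axisPt_mem_axis s)⟩

theorem EALines_subset [Finite F] {n : F} (hn : ∀ b : F, b ≠ 0 → ∃ d, d ≠ 0 ∧
    (b = d ^ 2 * 1 ∨ b = d ^ 2 * n)) :
    EALines F ⊆ transversalLines F ∪ concurrentLines 1 ∪ concurrentLines n := by
  rintro ℓ ⟨hext, hax, p, hp1, hp2⟩
  induction p using Projectivization.ind with | h v hv =>
  rw [onSub_mk] at hp1 hp2
  obtain ⟨hℓ, hC⟩ := isExternal_iff.1 hext
  obtain ⟨t, c, hc, rfl⟩ := exists_axisPt_of_mem_axis hp2 hv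
  rw [Submodule.smul_mem_iff _ hc] at hp1
  obtain ⟨w, hw, hwa⟩ : ∃ w ∈ ℓ, w ∉ axis F := by
    by_contra! h
    exact hax (Submodule.eq_of_le_of_finrank_eq h (hℓ.trans isLine_axis.symm))
  obtain ⟨s, y, z, d, hd, rfl⟩ := exists_pt_of_notMem_axis hwa
  rw [Submodule.smul_mem_iff _ hd] at hw
  have e : ℓ = eaLine t s y z := eq_span_axisPt_pt hℓ hp1 hw
  by_cases hst : s = t
  · subst hst
    rw [eaLine_self] at e
    have hz : z ≠ 0 := by
      rintro rfl
      refine hC s ?_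
      rw [e, vec_eq_pt]
      exact pt_mem_eaLine _ _ _ _
    obtain ⟨d, hd, rfl | rfl⟩ := hn z hz
    · exact Or.inl (Or.inr ⟨s, d, hd, e⟩)
    · exact Or.inr ⟨s, d, hd, e⟩
  · obtain ⟨a, b, hb, h⟩ := exists_pt_add_axisPt hst
    have h' := h y z (-z / b)
    rw [div_mul_cancel₀ _ hb, add_neg_cancel] at h'
    rw [eaLine_add _ _ _ _ _ h'] at e
    refine Or.inl (Or.inl ⟨s, t, _, hst, ?_, e⟩)
    intro h0
    refine hC s ?_
    rw [e, vec_eq_pt, h0]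
    exact pt_mem_eaLine _ _ _ _

theorem eaLine_inj {t t' s s' : OnePoint F} {y y' z z' : F}
    (h : eaLine t s y z = eaLine t' s' y' z') :
    t = t' ∧ s = s' ∧ ∃ c : F, pt s y z = pt s y' z' + c • axisPt t := by
  have h1 := axisPt_mem_eaLine t s y z
  have h2 := pt_mem_eaLine t s y z
  rw [h] at h1 h2
  obtain rfl := axisPt_mem_span.1 h1
  obtain ⟨rfl, h3⟩ := pt_mem_span.1 h2
  exact ⟨rfl, rfl, h3⟩

/-- A line of `transversalLines` determines its three parameters: the `TO`-point on it is unique. -/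
theorem eaLine_transversal_inj {t t' s s' : OnePoint F} {b b' : F} (hst : s ≠ t)
    (h : eaLine t s b 0 = eaLine t' s' b' 0) : t = t' ∧ s = s' ∧ b = b' := by
  obtain ⟨rfl, rfl, c, hc⟩ := eaLine_inj h
  obtain ⟨a, d, hd, h⟩ := exists_pt_add_axisPt hst
  rw [h, pt_inj] at hc
  obtain ⟨-, h1, h2⟩ := hc
  obtain rfl : c = 0 := by simpa [hd] using h2.symm
  exact ⟨rfl, rfl, by simpa using h1⟩

theorem eaLine_concurrent_inj {s t : OnePoint F} {b b' : F}
    (h : eaLine s s 0 b = eaLine t t 0 b') : s = t ∧ b = b' := by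
  obtain ⟨rfl, -, c, hc⟩ := eaLine_inj h
  rw [pt_add_axisPt_self, pt_inj] at hc
  exact ⟨rfl, hc.2.2⟩

theorem disjoint_transversal_concurrent (c : F) :
    Disjoint (transversalLines F) (concurrentLines c) := by
  rw [Set.disjoint_left]
  rintro _ ⟨s, t, b, hst, -, rfl⟩ ⟨s', d, -, h⟩
  obtain ⟨rfl, h, -⟩ := eaLine_inj h
  exact hst h

theorem disjoint_concurrent {n : F} (hn : ¬ IsSquare n) :
    Disjoint (concurrentLines 1) (concurrentLines n) := by
  rw [Set.disjoint_left]
  rintro _ ⟨s, d, -, rfl⟩ ⟨s', d', hd', h⟩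
  obtain ⟨rfl, h'⟩ := eaLine_concurrent_inj h
  refine hn ⟨d / d', ?_⟩
  field_simp
  linear_combination -h'

theorem scale_smul_transversal (k : Fˣ) (b : F) :
    scale k • eaLine ((0 : F) : OnePoint F) OnePoint.infty (k * b) 0 =
      eaLine ((0 : F) : OnePoint F) OnePoint.infty b 0 :=
  eq_span_axisPt_pt (isLine_smul (isLine_eaLine _ _ _ _))
    (mem_smul_of_apply_eq_smul k.ne_zero (axisPt_mem_eaLine _ _ _ _)
      (by simp [scale_apply]))
    (mem_smul_of_apply_eq_smul (c := k ^ 3) (by simp) (pt_mem_eaLine _ _ _ _)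
      (by simp [scale_apply]; ring))

theorem scale_smul_concurrent (k : Fˣ) (b : F) :
    scale k • eaLine OnePoint.infty OnePoint.infty 0 (k ^ 2 * b) =
      eaLine OnePoint.infty OnePoint.infty 0 b :=
  eq_span_axisPt_pt (isLine_smul (isLine_eaLine _ _ _ _))
    (mem_smul_of_apply_eq_smul (c := k ^ 2) (by simp) (axisPt_mem_eaLine _ _ _ _)
      (by simp [scale_apply]))
    (mem_smul_of_apply_eq_smul (c := k ^ 3) (by simp) (pt_mem_eaLine _ _ _ _)
      (by simp [scale_apply]; ring))

theorem isLineOrbit_transversalLines [Finite F] (hF : 5 < Nat.card F) :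
    IsLineOrbit (transversalLines F) := by
  refine isLineOrbit_of (ℓ := eaLine ((0 : F) : OnePoint F) OnePoint.infty 1 0)
    (isLine_eaLine _ _ _ _) ⟨_, _, _, by simp, one_ne_zero, rfl⟩ ?_ ?_
  · rintro g hg _ ⟨s, t, b, hst, hb, rfl⟩
    obtain ⟨σ, hσ⟩ := exists_actsBy_of_mem_G hF hg
    obtain ⟨e, f, d, he, -, h⟩ := hσ.smul_eaLine s
    refine ⟨σ s, σ t, e * b, fun h => hst (σ.injective h), mul_ne_zero he hb, ?_⟩
    rw [h]; simp
  · rintro _ ⟨s, t, b, hst, hb, rfl⟩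
    obtain ⟨g, σ, hσ, h1, h2⟩ := exists_actsBy_two_points hst
    obtain ⟨e, f, d, he, -, h⟩ := hσ.smul_eaLine s
    refine ⟨scale (Units.mk0 _ (mul_ne_zero he hb)) * g,
      mul_mem (scale_actsBy _).mem_G hσ.mem_G, ?_⟩
    rw [mul_smul, h, h1, h2]
    simpa using scale_smul_transversal (Units.mk0 _ (mul_ne_zero he hb)) 1

theorem isLineOrbit_concurrentLines [Finite F] (hF : 5 < Nat.card F) (c : F) :
    IsLineOrbit (concurrentLines c) := by
  refine isLineOrbit_of (ℓ := eaLine OnePoint.infty OnePoint.infty 0 c)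
    (isLine_eaLine _ _ _ _) ⟨OnePoint.infty, 1, one_ne_zero, by simp⟩ ?_ ?_
  · rintro g hg _ ⟨s, b, hb, rfl⟩
    obtain ⟨σ, hσ⟩ := exists_actsBy_of_mem_G hF hg
    obtain ⟨e, f, d, -, hd, h⟩ := hσ.smul_eaLine s
    refine ⟨σ s, d * b, mul_ne_zero hd hb, ?_⟩
    rw [h, eaLine_self]
    congr 1; ring
  · rintro _ ⟨s, b, hb, rfl⟩
    obtain ⟨r, hr⟩ : ∃ r, r ≠ s := exists_ne (α := Option F) s
    obtain ⟨g, σ, hσ, h1, h2⟩ := exists_actsBy_two_points hr.symm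
    obtain ⟨e, f, d, -, hd, h⟩ := hσ.smul_eaLine s
    refine ⟨scale (Units.mk0 _ (mul_ne_zero hd hb)) * g,
      mul_mem (scale_actsBy _).mem_G hσ.mem_G, ?_⟩
    rw [mul_smul, h, h1, eaLine_self]
    have := scale_smul_concurrent (Units.mk0 _ (mul_ne_zero hd hb)) c
    rw [Units.val_mk0] at this
    rw [← this]
    congr 2; ring

theorem ncard_ne_pairs (α : Type*) [Finite α] :
    {p : α × α | p.1 ≠ p.2}.ncard = Nat.card α * Nat.card α - Nat.card α := by
  classical
  have := Fintype.ofFinite α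
  rw [show {p : α × α | p.1 ≠ p.2} = ((Finset.univ : Finset α).offDiag : Set (α × α)) by
    ext; simp, Set.ncard_coe_finset, Finset.offDiag_card, Nat.card_eq_fintype_card,
    Finset.card_univ]

theorem ncard_ne (α : Type*) [Finite α] (a : α) : {b | b ≠ a}.ncard = Nat.card α - 1 := by
  have := Set.ncard_compl ({a} : Set α)
  rwa [Set.ncard_singleton] at this

theorem ncard_transversalLines [Finite F] :
    (transversalLines F).ncard = (Nat.card F + 1) * Nat.card F * (Nat.card F - 1) := by
  have h : transversalLines F = (fun x : (OnePoint F × OnePoint F) × F =>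
      eaLine x.1.2 x.1.1 x.2 0) '' ({p | p.1 ≠ p.2} ×ˢ {b | b ≠ 0}) := by
    ext ℓ
    constructor
    · rintro ⟨s, t, b, hst, hb, rfl⟩; exact ⟨((s, t), b), ⟨hst, hb⟩, rfl⟩
    · rintro ⟨⟨⟨s, t⟩, b⟩, ⟨hst, hb⟩, rfl⟩; exact ⟨s, t, b, hst, hb, rfl⟩
  rw [h, Set.InjOn.ncard_image, Set.ncard_prod, ncard_ne_pairs, ncard_ne, card_onePoint]
  · congr 1
    rw [← Nat.mul_sub_one, Nat.add_sub_cancel]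
  · rintro ⟨⟨s, t⟩, b⟩ ⟨hst, -⟩ ⟨⟨s', t'⟩, b'⟩ _ h
    obtain ⟨rfl, rfl, rfl⟩ := eaLine_transversal_inj hst h
    rfl

theorem ncard_concurrentLines_eq [Finite F] {c : F} (hc : c ≠ 0) :
    (concurrentLines c).ncard = (Nat.card F + 1) * {b : F | ∃ d, d ≠ 0 ∧ b = d ^ 2}.ncard := by
  have h : concurrentLines c = (fun x : OnePoint F × F => eaLine x.1 x.1 0 (x.2 * c)) ''
      (Set.univ ×ˢ {b : F | ∃ d, d ≠ 0 ∧ b = d ^ 2}) := by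
    ext ℓ
    constructor
    · rintro ⟨s, d, hd, rfl⟩; exact ⟨(s, d ^ 2), ⟨trivial, d, hd, rfl⟩, rfl⟩
    · rintro ⟨⟨s, _⟩, ⟨-, d, hd, rfl⟩, rfl⟩; exact ⟨s, d, hd, rfl⟩
  rw [h, Set.ncard_image_of_injective, Set.ncard_prod, Set.ncard_univ, card_onePoint]
  rintro ⟨s, b⟩ ⟨s', b'⟩ h
  obtain ⟨rfl, h⟩ := eaLine_concurrent_inj h
  exact congrArg _ (mul_right_cancel₀ hc h)

variable (F) in
theorem exists_nonsquare_dichotomy [Finite F] : ∃ n : F, ¬ IsSquare n ∧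
    ∀ b : F, b ≠ 0 → ∃ d, d ≠ 0 ∧ (b = d ^ 2 * 1 ∨ b = d ^ 2 * n) := by
  classical
  have := Fintype.ofFinite F
  have h2 : ringChar F ≠ 2 := by rw [ringChar.eq F 3]; decide
  obtain ⟨n, hn⟩ := FiniteField.exists_nonsquare h2
  have hn0 : n ≠ 0 := by rintro rfl; exact hn (IsSquare.zero)
  refine ⟨n, hn, fun b hb => ?_⟩
  by_cases hsq : IsSquare b
  · obtain ⟨d, rfl⟩ := hsq
    exact ⟨d, left_ne_zero_of_mul hb, Or.inl (by ring)⟩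
  · have e1 := quadraticChar_neg_one_iff_not_isSquare.2 hn
    have e2 := quadraticChar_neg_one_iff_not_isSquare.2 hsq
    have h3 : quadraticChar F (b * n) = 1 := by rw [map_mul, e1, e2]; norm_num
    obtain ⟨d, hd⟩ := (quadraticChar_one_iff_isSquare (mul_ne_zero hb hn0)).1 h3
    have hd0 : d ≠ 0 := by rintro rfl; simp [hb, hn0] at hd
    refine ⟨d / n, div_ne_zero hd0 hn0, Or.inr ?_⟩
    field_simp
    linear_combination hd

theorem ncard_squares [Finite F] :
    2 * {b : F | ∃ d, d ≠ 0 ∧ b = d ^ 2}.ncard = Nat.card F - 1 := by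
  obtain ⟨n, hn, h⟩ := exists_nonsquare_dichotomy F
  have hn0 : n ≠ 0 := by rintro rfl; exact hn (IsSquare.zero)
  set S := {b : F | ∃ d, d ≠ 0 ∧ b = d ^ 2} with hS
  have hT : ((fun x => x * n) '' S).ncard = S.ncard :=
    Set.ncard_image_of_injective _ (mul_left_injective₀ hn0)
  have hd : Disjoint S ((fun x => x * n) '' S) := by
    rw [Set.disjoint_left]
    rintro _ ⟨d, hd, rfl⟩ ⟨_, ⟨e, he, rfl⟩, h⟩
    refine hn ⟨d / e, ?_⟩
    field_simp
    linear_combination h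
  have hu : S ∪ (fun x => x * n) '' S = {b | b ≠ 0} := by
    ext b
    constructor
    · rintro (⟨d, hd, rfl⟩ | ⟨_, ⟨e, he, rfl⟩, rfl⟩)
      · exact pow_ne_zero 2 hd
      · exact mul_ne_zero (pow_ne_zero 2 he) hn0
    · intro hb
      obtain ⟨d, hd, rfl | rfl⟩ := h b hb
      · exact Or.inl ⟨d, hd, by ring⟩
      · exact Or.inr ⟨_, ⟨d, hd, rfl⟩, rfl⟩
  rw [← ncard_ne F 0, ← hu, Set.ncard_union_eq hd, hT, two_mul]

theorem two_mul_ncard_concurrentLines [Finite F] {c : F} (hc : c ≠ 0) :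
    2 * (concurrentLines c).ncard = (Nat.card F + 1) * (Nat.card F - 1) := by
  rw [ncard_concurrentLines_eq hc, mul_left_comm, ncard_squares]

/-! ### `TO`-points on the lines meeting the axis -/

theorem pt_mem_transversal {s t s' : OnePoint F} {b b' : F} (hst : s ≠ t) :
    pt s' b' 0 ∈ eaLine t s b 0 ↔ s' = s ∧ b' = b := by
  constructor
  · intro h
    obtain ⟨rfl, c, hc⟩ := pt_mem_span.1 h
    exact ⟨rfl, ((eaLine_transversal_inj hst (eaLine_add _ _ _ _ _ hc.symm)).2.2).symm⟩
  · rintro ⟨rfl, rfl⟩; exact pt_mem_eaLine _ _ _ _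

theorem pt_notMem_concurrent {c b : F} (hc : c ≠ 0) (s : OnePoint F) {ℓ : Submodule F (V F)}
    (hℓ : ℓ ∈ concurrentLines c) : pt s b 0 ∉ ℓ := by
  obtain ⟨s', d, hd, rfl⟩ := hℓ
  intro h
  obtain ⟨rfl, a, ha⟩ := pt_mem_span.1 h
  rw [pt_add_axisPt_self, pt_inj] at ha
  exact mul_ne_zero (pow_ne_zero 2 hd) hc ha.2.2.symm

theorem numPoints_transversal [Finite F] {ℓ : Submodule F (V F)} (hℓ : ℓ ∈ transversalLines F) :
    numPoints (TOPoints F) ℓ = 1 := by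
  obtain ⟨s, t, b, hst, hb, rfl⟩ := hℓ
  refine Set.ncard_eq_one.2 ⟨Projectivization.mk F (pt s b 0) (pt_ne_zero s b 0), ?_⟩
  ext p
  constructor
  · rintro ⟨hp, h⟩
    obtain ⟨s', b', -, rfl⟩ := mem_TOPoints_iff.1 hp
    obtain ⟨rfl, rfl⟩ := (pt_mem_transversal hst).1 (onSub_mk.1 h)
    rfl
  · rintro rfl
    exact ⟨mem_TOPoints_iff.2 ⟨s, b, hb, rfl⟩, onSub_mk.2 (pt_mem_eaLine _ _ _ _)⟩

theorem numPoints_concurrent [Finite F] {c : F} (hc : c ≠ 0) {ℓ : Submodule F (V F)}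
    (hℓ : ℓ ∈ concurrentLines c) : numPoints (TOPoints F) ℓ = 0 := by
  rw [numPoints, Set.ncard_eq_zero]
  refine Set.eq_empty_of_forall_notMem ?_
  rintro p ⟨hp, h⟩
  obtain ⟨s, b, -, rfl⟩ := mem_TOPoints_iff.1 hp
  exact pt_notMem_concurrent hc s hℓ (onSub_mk.1 h)

theorem numLines_concurrent [Finite F] {c : F} (hc : c ≠ 0) {p : ℙ F (V F)}
    (hp : p ∈ TOPoints F) : numLines (concurrentLines c) p = 0 := by
  rw [numLines, Set.ncard_eq_zero]
  refine Set.eq_empty_of_forall_notMem ?_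
  rintro ℓ ⟨hℓ, h⟩
  obtain ⟨s, b, -, rfl⟩ := mem_TOPoints_iff.1 hp
  exact pt_notMem_concurrent hc s hℓ (onSub_mk.1 h)

theorem numLines_transversal [Finite F] {p : ℙ F (V F)} (hp : p ∈ TOPoints F) :
    numLines (transversalLines F) p = Nat.card F := by
  obtain ⟨s, b, hb, rfl⟩ := mem_TOPoints_iff.1 hp
  have h : {ℓ | ℓ ∈ transversalLines F ∧ OnSub (Projectivization.mk F _ (pt_ne_zero s b 0)) ℓ} =
      (fun t => eaLine t s b 0) '' {t | t ≠ s} := by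
    ext ℓ
    constructor
    · rintro ⟨⟨s', t, b', hst, hb', rfl⟩, h⟩
      obtain ⟨rfl, rfl⟩ := (pt_mem_transversal hst).1 (onSub_mk.1 h)
      exact ⟨t, hst.symm, rfl⟩
    · rintro ⟨t, ht, rfl⟩
      exact ⟨⟨s, t, b, ht.symm, hb, rfl⟩, onSub_mk.2 (pt_mem_eaLine _ _ _ _)⟩
  rw [numLines, h, Set.InjOn.ncard_image, ncard_ne, card_onePoint, Nat.add_sub_cancel]
  intro t ht t' _ h
  exact (eaLine_transversal_inj (Ne.symm ht) h).1

theorem ncard_TOPoints [Finite F] :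
    (TOPoints F).ncard = (Nat.card F + 1) * (Nat.card F - 1) := by
  have h : TOPoints F = (fun x : OnePoint F × F =>
      Projectivization.mk F (pt x.1 x.2 0) (pt_ne_zero x.1 x.2 0)) ''
      (Set.univ ×ˢ {b | b ≠ 0}) := by
    ext p
    rw [mem_TOPoints_iff]
    constructor
    · rintro ⟨s, b, hb, rfl⟩; exact ⟨(s, b), ⟨trivial, hb⟩, rfl⟩
    · rintro ⟨⟨s, b⟩, ⟨-, hb⟩, rfl⟩; exact ⟨s, b, hb, rfl⟩
  rw [h, Set.ncard_image_of_injective, Set.ncard_prod, ncard_ne, Set.ncard_univ, card_onePoint]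
  rintro ⟨s, b⟩ ⟨s', b'⟩ h
  obtain ⟨rfl, rfl, -⟩ := mk_pt_inj.1 h
  rfl

end EALines

/-! ### Lines skew to the axis -/

section SkewLines

variable {F : Type*} [Field F]

/-- The line `x₁ = a x₀ + c x₃`, `x₂ = b x₀ + d x₃`. In characteristic `3`, where the axis is
`x₀ = x₃ = 0`, these are the lines skew to the axis. -/
def skewLine (a b c d : F) : Submodule F (V F) :=
  Submodule.span F {![1, a, b, 0], ![0, c, d, 1]}

theorem mem_skewLine {a b c d : F} {x : V F} :
    x ∈ skewLine a b c d ↔ x 1 = a * x 0 + c * x 3 ∧ x 2 = b * x 0 + d * x 3 := by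
  rw [skewLine, Submodule.mem_span_pair]
  constructor
  · rintro ⟨y, z, rfl⟩
    simp; constructor <;> ring
  · rintro ⟨h1, h2⟩
    refine ⟨x 0, x 3, V_ext_iff.2 ⟨by simp, ?_, ?_, by simp⟩⟩
    · simp [h1]; ring
    · simp [h2]; ring

theorem isLine_span_pair {v w : V F} (h : ∀ a b : F, a • v + b • w = 0 → a = 0 ∧ b = 0) :
    IsLine (Submodule.span F {v, w}) := by
  have h2 := finrank_span_eq_card (LinearIndependent.pair_iff.2 h)
  rw [Matrix.range_cons_cons_empty] at h2
  simpa [IsLine] using h2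

theorem isLine_skewLine (a b c d : F) : IsLine (skewLine a b c d) :=
  isLine_span_pair fun y z h => by simp at h; exact ⟨h.1, h.2.2.2⟩

theorem skewLine_inj {a b c d a' b' c' d' : F} (h : skewLine a b c d = skewLine a' b' c' d') :
    a = a' ∧ b = b' ∧ c = c' ∧ d = d' := by
  have h1 : ![1, a, b, 0] ∈ skewLine a b c d := mem_skewLine.2 (by simp)
  have h2 : ![0, c, d, 1] ∈ skewLine a b c d := mem_skewLine.2 (by simp)
  rw [h, mem_skewLine] at h1 h2
  simp at h1 h2
  exact ⟨h1.1, h1.2, h2.1, h2.2⟩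

variable (F) in
/-- The set of lines of the form `skewLine a b c d`. -/
def skewLines : Set (Submodule F (V F)) := {ℓ | ∃ a b c d, ℓ = skewLine a b c d}

theorem isLine_of_mem_skewLines {ℓ : Submodule F (V F)} (h : ℓ ∈ skewLines F) : IsLine ℓ := by
  obtain ⟨a, b, c, d, rfl⟩ := h; exact isLine_skewLine _ _ _ _

theorem ncard_skewLines : (skewLines F).ncard = Nat.card F ^ 4 := by
  have h : skewLines F = (fun x : (F × F) × (F × F) => skewLine x.1.1 x.1.2 x.2.1 x.2.2) ''
      Set.univ := by
    ext ℓ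
    constructor
    · rintro ⟨a, b, c, d, rfl⟩; exact ⟨((a, b), (c, d)), trivial, rfl⟩
    · rintro ⟨⟨⟨a, b⟩, ⟨c, d⟩⟩, -, rfl⟩; exact ⟨a, b, c, d, rfl⟩
  rw [h, Set.ncard_image_of_injective, Set.ncard_univ, Nat.card_prod, Nat.card_prod]
  · ring
  · rintro ⟨⟨a, b⟩, ⟨c, d⟩⟩ ⟨⟨a', b'⟩, ⟨c', d'⟩⟩ h
    obtain ⟨rfl, rfl, rfl, rfl⟩ := skewLine_inj h
    rfl

theorem ncard_skewLines_through (s : OnePoint F) (y z : F) :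
    {ℓ | ℓ ∈ skewLines F ∧ pt s y z ∈ ℓ}.ncard = Nat.card F ^ 2 := by
  induction s using OnePoint.rec with
  | infty =>
    have h : {ℓ | ℓ ∈ skewLines F ∧ pt OnePoint.infty y z ∈ ℓ} =
        (fun x : F × F => skewLine y z x.1 x.2) '' Set.univ := by
      ext ℓ
      constructor
      · rintro ⟨⟨a, b, c, d, rfl⟩, h⟩
        rw [mem_skewLine] at h
        simp at h
        obtain ⟨rfl, rfl⟩ := h
        exact ⟨(c, d), trivial, rfl⟩
      · rintro ⟨⟨c, d⟩, -, rfl⟩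
        exact ⟨⟨y, z, c, d, rfl⟩, mem_skewLine.2 (by simp)⟩
    rw [h, Set.ncard_image_of_injective, Set.ncard_univ, Nat.card_prod, sq]
    rintro ⟨c, d⟩ ⟨c', d'⟩ h
    obtain ⟨-, -, rfl, rfl⟩ := skewLine_inj h
    rfl
  | coe s =>
    have h : {ℓ | ℓ ∈ skewLines F ∧ pt (s : OnePoint F) y z ∈ ℓ} =
        (fun x : F × F => skewLine x.1 x.2 (s ^ 2 - s * y + z - x.1 * s ^ 3)
          (s + y - x.2 * s ^ 3)) '' Set.univ := by
      ext ℓ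
      constructor
      · rintro ⟨⟨a, b, c, d, rfl⟩, h⟩
        rw [mem_skewLine] at h
        simp at h
        obtain ⟨h1, h2⟩ := h
        refine ⟨(a, b), trivial, ?_⟩
        simp [h1, h2]
      · rintro ⟨⟨c, d⟩, -, rfl⟩
        exact ⟨⟨_, _, _, _, rfl⟩, mem_skewLine.2 (by simp)⟩
    rw [h, Set.ncard_image_of_injective, Set.ncard_univ, Nat.card_prod, sq]
    rintro ⟨a, b⟩ ⟨a', b'⟩ h
    obtain ⟨rfl, rfl, -, -⟩ := skewLine_inj h
    rfl

theorem mem_skewLines_of_forall {ℓ : Submodule F (V F)} (hℓ : IsLine ℓ)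
    (h : ∀ x ∈ ℓ, x 0 = 0 → x 3 = 0 → x = 0) : ℓ ∈ skewLines F := by
  let f : ℓ →ₗ[F] F × F :=
    ((LinearMap.proj 0).prod (LinearMap.proj 3)).comp ℓ.subtype
  have hf : ∀ x : ℓ, f x = ((x : V F) 0, (x : V F) 3) := fun x => rfl
  have hinj : Function.Injective f := by
    rw [injective_iff_map_eq_zero]
    intro x hx
    rw [hf, Prod.mk_eq_zero] at hx
    exact Subtype.ext (h x x.2 hx.1 hx.2)
  have hsurj : Function.Surjective f :=
    (LinearMap.injective_iff_surjective_of_finrank_eq_finrank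
      (hℓ.trans (by simp))).1 hinj
  obtain ⟨⟨v, hv⟩, hv'⟩ := hsurj (1, 0)
  obtain ⟨⟨w, hw⟩, hw'⟩ := hsurj (0, 1)
  rw [hf, Prod.mk_inj] at hv' hw'
  refine ⟨v 1, v 2, w 1, w 2, (Submodule.eq_of_le_of_finrank_eq ?_ ?_).symm⟩
  · rw [skewLine, Submodule.span_le]
    have ev : ![1, v 1, v 2, 0] = v := V_ext_iff.2 ⟨hv'.1.symm, rfl, rfl, hv'.2.symm⟩
    have ew : ![0, w 1, w 2, 1] = w := V_ext_iff.2 ⟨hw'.1.symm, rfl, rfl, hw'.2.symm⟩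
    rw [ev, ew]
    rintro x (rfl | rfl) <;> assumption
  · rw [isLine_skewLine, hℓ]

/-- The line `x₀ - u x₁ + v x₂ = 0`, `x₁ - u x₂ + v x₃ = 0`. It is the join of the points of the
cubic whose parameters are the roots of `X² - u X + v`, over any field containing them. -/
def chordLine (u v : F) : Submodule F (V F) :=
  Submodule.span F {![u ^ 2 - v, u, 1, 0], ![-(u * v), -v, 0, 1]}

theorem mem_chordLine {u v : F} {x : V F} :
    x ∈ chordLine u v ↔ x 0 - u * x 1 + v * x 2 = 0 ∧ x 1 - u * x 2 + v * x 3 = 0 := by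
  rw [chordLine, Submodule.mem_span_pair]
  constructor
  · rintro ⟨y, z, rfl⟩
    simp; constructor <;> ring
  · rintro ⟨h1, h2⟩
    refine ⟨x 2, x 3, V_ext_iff.2 ⟨?_, ?_, by simp, by simp⟩⟩
    · simp; linear_combination -h1 - u * h2
    · simp; linear_combination -h2

theorem isLine_chordLine (u v : F) : IsLine (chordLine u v) :=
  isLine_span_pair fun y z h => by simp at h; exact ⟨h.2.2.1, h.2.2.2⟩

theorem chordLine_inj {u v u' v' : F} (h : chordLine u v = chordLine u' v') : u = u' ∧ v = v' := by
  have h1 : ![-(u * v), -v, 0, 1] ∈ chordLine u v := mem_chordLine.2 (by simp)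
  have h2 : ![u ^ 2 - v, u, 1, 0] ∈ chordLine u v := mem_chordLine.2 (by simp; ring)
  rw [h, mem_chordLine] at h1 h2
  simp at h1 h2
  exact ⟨by linear_combination h2.2, by linear_combination -h1.2⟩

theorem vec_mem_chordLine {u v r : F} :
    vec (r : OnePoint F) ∈ chordLine u v ↔ r ^ 2 - u * r + v = 0 := by
  rw [mem_chordLine]
  simp
  intro h
  linear_combination r * h

theorem vec_infty_notMem_chordLine (u v : F) : vec OnePoint.infty ∉ chordLine u v := by
  rw [mem_chordLine]; simp

theorem chordLine_mem_skewLines {u v : F} (h : u ^ 2 - v ≠ 0) : chordLine u v ∈ skewLines F := by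
  refine mem_skewLines_of_forall (isLine_chordLine u v) fun x hx h0 h3 => ?_
  rw [mem_chordLine, h0, h3] at hx
  obtain ⟨h1, h2⟩ := hx
  have hx2 : x 2 = 0 := by
    have : (u ^ 2 - v) * x 2 = 0 := by linear_combination -h1 - u * h2
    simpa [h] using this
  exact V_ext_iff.2 ⟨h0, by simpa [hx2] using h2, hx2, h3⟩

variable [CharP F 3]

theorem eq_zero_of_mem_skewLines {ℓ : Submodule F (V F)} (h : ℓ ∈ skewLines F) {x : V F}
    (hx : x ∈ ℓ) (ha : x ∈ axis F) : x = 0 := by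
  obtain ⟨a, b, c, d, rfl⟩ := h
  rw [mem_skewLine] at hx
  obtain ⟨h0, h3⟩ := mem_axis.1 ha
  exact V_ext_iff.2 ⟨h0, by simp [hx.1, h0, h3], by simp [hx.2, h0, h3], h3⟩

theorem axisPt_notMem_of_mem_skewLines {ℓ : Submodule F (V F)} (h : ℓ ∈ skewLines F)
    (t : OnePoint F) : axisPt t ∉ ℓ := fun ht =>
  axisPt_ne_zero t (eq_zero_of_mem_skewLines h ht (axisPt_mem_axis t))

theorem smul_pt_add_smul_pt_mem_axis {s r : OnePoint F} (h : s ≠ r) {y z y' z' a b : F}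
    (hx : a • pt s y z + b • pt r y' z' ∈ axis F) : a = 0 ∧ b = 0 := by
  rw [mem_axis] at hx
  induction s using OnePoint.rec <;> induction r using OnePoint.rec
  · exact absurd rfl h
  · simp at hx
    obtain ⟨h1, rfl⟩ := hx
    simpa using h1
  · simp at hx
    obtain ⟨h1, rfl⟩ := hx
    simpa using h1
  · rename_i s r
    simp at hx
    obtain ⟨h1, h2⟩ := hx
    have h3 : a * (s ^ 3 - r ^ 3) = 0 := by linear_combination h1 - r ^ 3 * h2
    have h4 : s ^ 3 - r ^ 3 ≠ 0 := sub_ne_zero.2 fun e => h (by rw [cube_inj e])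
    obtain rfl : a = 0 := by simpa [h4] using h3
    simpa using h2

theorem span_pt_pt_mem_skewLines {s r : OnePoint F} (h : s ≠ r) (y z y' z' : F) :
    Submodule.span F {pt s y z, pt r y' z'} ∈ skewLines F := by
  refine mem_skewLines_of_forall (isLine_span_pair fun a b hab =>
    smul_pt_add_smul_pt_mem_axis h (hab ▸ zero_mem _)) ?_
  intro x hx h0 h3
  obtain ⟨a, b, rfl⟩ := Submodule.mem_span_pair.1 hx
  obtain ⟨rfl, rfl⟩ := smul_pt_add_smul_pt_mem_axis h (mem_axis.2 ⟨h0, h3⟩)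
  simp

theorem eq_span_pt_pt {ℓ : Submodule F (V F)} (hℓ : IsLine ℓ) {s r : OnePoint F} (h : s ≠ r)
    {y z y' z' : F} (h1 : pt s y z ∈ ℓ) (h2 : pt r y' z' ∈ ℓ) :
    ℓ = Submodule.span F {pt s y z, pt r y' z'} := by
  refine (Submodule.eq_of_le_of_finrank_eq ?_ ?_).symm
  · rw [Submodule.span_le]; rintro x (rfl | rfl) <;> assumption
  · rw [hℓ, isLine_of_mem_skewLines (span_pt_pt_mem_skewLines h _ _ _ _)]

theorem eq_chordLine_of_mem {ℓ : Submodule F (V F)} (hℓ : IsLine ℓ) {r r' : F} (h : r ≠ r')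
    (h1 : vec (r : OnePoint F) ∈ ℓ) (h2 : vec (r' : OnePoint F) ∈ ℓ) :
    ℓ = chordLine (r + r') (r * r') := by
  have hne : (r : OnePoint F) ≠ r' := fun e => h (OnePoint.coe_injective e)
  have h1' : vec (r : OnePoint F) ∈ chordLine (r + r') (r * r') := vec_mem_chordLine.2 (by ring)
  have h2' : vec (r' : OnePoint F) ∈ chordLine (r + r') (r * r') := vec_mem_chordLine.2 (by ring)
  rw [vec_eq_pt] at h1 h2 h1' h2'
  rw [eq_span_pt_pt hℓ hne h1 h2]
  exact (eq_span_pt_pt (isLine_chordLine _ _) hne h1' h2').symm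

/-- If a point of the tangent at `P(s)`, off the axis, lies on `chordLine u v`, then `s` is a root
of the corresponding quadratic, so that `P(s)` lies on this line too. -/
theorem exists_root_of_pt_mem_chordLine {u v b : F} {s : OnePoint F}
    (h : pt s b 0 ∈ chordLine u v) : ∃ r : F, s = r ∧ r ^ 2 - u * r + v = 0 := by
  have h3 := three_eq_zero F
  rw [mem_chordLine] at h
  induction s using OnePoint.rec with
  | infty =>
    simp at h
    obtain ⟨h1, rfl⟩ := h
    simp at h1
  | coe s =>
    refine ⟨s, rfl, ?_⟩
    simp at h
    obtain ⟨h1, h2⟩ := h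
    -- eliminating `b` between the two equations shows that `b` annihilates the quadratic
    have hb : b * (s ^ 2 - u * s + v) = 0 := by
      linear_combination h1 - s * h2 - (b * s * u) * h3
    rcases mul_eq_zero.1 hb with rfl | hb
    · linear_combination h2
    · exact hb

/-- A point of a tangent, off the axis, is not on the join of two other points of the cubic. -/
theorem eq_or_eq_of_collinear {ℓ : Submodule F (V F)} (hℓ : IsLine ℓ) {s r r' : OnePoint F}
    (hr : r ≠ r') {b : F} (h : pt s b 0 ∈ ℓ) (h1 : vec r ∈ ℓ) (h2 : vec r' ∈ ℓ) :
    s = r ∨ s = r' := by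
  have h3 := three_eq_zero F
  have key : ∀ r : F, vec OnePoint.infty ∈ ℓ → vec (r : OnePoint F) ∈ ℓ →
      s = OnePoint.infty ∨ s = r := by
    intro r h1 h2
    rw [vec_eq_pt] at h1 h2
    rw [eq_span_pt_pt hℓ (OnePoint.infty_ne_coe r) h1 h2, Submodule.mem_span_pair] at h
    obtain ⟨x, y, hxy⟩ := h
    induction s using OnePoint.rec with
    | infty => exact Or.inl rfl
    | coe s =>
      right
      simp at hxy
      obtain ⟨-, e1, e2, rfl⟩ := hxy
      have hb : b ^ 2 = 0 := by
        have e3 : r = s + b := by linear_combination e2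
        rw [e3] at e1
        linear_combination e1 - s * b * h3
      obtain rfl : b = 0 := by simpa using hb
      simpa using e2.symm
  induction r using OnePoint.rec with
  | infty =>
    induction r' using OnePoint.rec with
    | infty => exact absurd rfl hr
    | coe r' => exact key r' h1 h2
  | coe r =>
    induction r' using OnePoint.rec with
    | infty => exact (key r h2 h1).symm
    | coe r' =>
      rw [eq_chordLine_of_mem hℓ (fun e => hr (by rw [e])) h1 h2] at h
      obtain ⟨t, rfl, ht⟩ := exists_root_of_pt_mem_chordLine h
      have : (t - r) * (t - r') = 0 := by linear_combination ht
      rcases mul_eq_zero.1 this with h | h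
      · exact Or.inl (by rw [sub_eq_zero.1 h])
      · exact Or.inr (by rw [sub_eq_zero.1 h])

/-- The lines skew to the axis through a given point of the tangent at `P(s)` which contain no
point of the cubic other than `P(s)`. -/
def unisecants (s : OnePoint F) (b : F) : Set (Submodule F (V F)) :=
  {ℓ | ℓ ∈ skewLines F ∧ pt s b 0 ∈ ℓ ∧ ∀ r, r ≠ s → vec r ∉ ℓ}

/-- The skew lines through the given point that contain a point of the cubic other than `P(s)`
correspond to those `q` points, by `eq_or_eq_of_collinear`. -/
theorem ncard_unisecants [Finite F] (s : OnePoint F) (b : F) :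
    (unisecants s b).ncard = Nat.card F ^ 2 - Nat.card F := by
  have h : unisecants s b = {ℓ | ℓ ∈ skewLines F ∧ pt s b 0 ∈ ℓ} \
      (fun r => Submodule.span F {pt s b 0, vec r}) '' {r | r ≠ s} := by
    ext ℓ
    constructor
    · rintro ⟨h1, h2, h3⟩
      refine ⟨⟨h1, h2⟩, ?_⟩
      rintro ⟨r, hr, rfl⟩
      exact h3 r hr (Submodule.subset_span (by simp))
    · rintro ⟨⟨h1, h2⟩, h3⟩
      refine ⟨h1, h2, fun r hr hrℓ => h3 ⟨r, hr, ?_⟩⟩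
      rw [vec_eq_pt] at hrℓ
      simp only [vec_eq_pt]
      exact (eq_span_pt_pt (isLine_of_mem_skewLines h1) (Ne.symm hr) h2 hrℓ).symm
  rw [h, Set.ncard_sdiff, ncard_skewLines_through, Set.InjOn.ncard_image, ncard_ne,
    card_onePoint, Nat.add_sub_cancel]
  · intro r hr r' hr' e
    by_contra hne
    have hr1 : vec r ∈ Submodule.span F {pt s b 0, vec r} := Submodule.subset_span (by simp)
    have hr2 : vec r' ∈ Submodule.span F {pt s b 0, vec r'} := Submodule.subset_span (by simp)
    have e' : Submodule.span F {pt s b 0, vec r} = Submodule.span F {pt s b 0, vec r'} := e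
    rw [← e'] at hr2
    have hl : IsLine (Submodule.span F {pt s b 0, vec r}) := by
      rw [vec_eq_pt]
      exact isLine_of_mem_skewLines (span_pt_pt_mem_skewLines (Ne.symm hr) _ _ _ _)
    have hsℓ : pt s b 0 ∈ Submodule.span F {pt s b 0, vec r} := Submodule.subset_span (by simp)
    rcases eq_or_eq_of_collinear hl hne hsℓ hr1 hr2 with h | h
    · exact hr h.symm
    · exact hr' h.symm
  · rintro _ ⟨r, hr, rfl⟩
    refine ⟨?_, Submodule.subset_span (by simp)⟩
    simp only [vec_eq_pt]
    exact span_pt_pt_mem_skewLines (Ne.symm hr) _ _ _ _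

end SkewLines

/-! ### Imaginary chords -/

section ImaginaryChords

variable {F : Type*} [Field F]

theorem mem_range_algebraMap_of_pow_card [Finite F] {K : Type*} [Field K] [Algebra F K] {x : K}
    (hx : x ^ Nat.card F = x) : ∃ a : F, algebraMap F K a = x := by
  classical
  have := Fintype.ofFinite F
  rw [Nat.card_eq_fintype_card] at hx
  let p : Polynomial K := Polynomial.X ^ Fintype.card F - Polynomial.X
  have hp : p ≠ 0 := FiniteField.X_pow_card_sub_X_ne_zero K Fintype.one_lt_card
  have hdeg : p.natDegree = Fintype.card F :=
    FiniteField.X_pow_card_sub_X_natDegree_eq K Fintype.one_lt_card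
  have hmem : ∀ y : K, y ∈ p.roots.toFinset ↔ y ^ Fintype.card F = y := by
    intro y
    simp [p, hp, Polynomial.mem_roots', sub_eq_zero]
  have hsub : Finset.univ.image (algebraMap F K) ⊆ p.roots.toFinset := by
    intro y hy
    obtain ⟨a, -, rfl⟩ := Finset.mem_image.1 hy
    rw [hmem, ← map_pow, FiniteField.pow_card]
  have heq := Finset.eq_of_subset_of_card_le hsub (by
    rw [Finset.card_image_of_injective _ (algebraMap F K).injective, Finset.card_univ, ← hdeg]
    exact (Multiset.toFinset_card_le _).trans (Polynomial.card_roots' p))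
  have h := (hmem x).2 hx
  rw [← heq] at h
  obtain ⟨a, -, ha⟩ := Finset.mem_image.1 h
  exact ⟨a, ha⟩

theorem span_vec_vec {K : Type*} [Field K] {t t' : K} (h : t ≠ t') :
    Submodule.span K {vec (t : OnePoint K), vec (t' : OnePoint K)} =
      chordLine (t + t') (t * t') := by
  have hl : IsLine (Submodule.span K {vec (t : OnePoint K), vec (t' : OnePoint K)}) := by
    refine isLine_span_pair fun a b hab => ?_
    simp at hab
    obtain ⟨-, -, h1, h2⟩ := hab
    have h3 : a * (t - t') = 0 := by linear_combination h1 - t' * h2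
    obtain rfl : a = 0 := by simpa [sub_ne_zero.2 h] using h3
    simpa using h2
  refine Submodule.eq_of_le_of_finrank_eq ?_ (hl.trans (isLine_chordLine _ _).symm)
  rw [Submodule.span_le]
  rintro x (rfl | rfl) <;> exact vec_mem_chordLine.2 (by ring)

theorem extend_chordLine (K : Type*) [Field K] [Algebra F K] (u v : F) :
    extend K (chordLine u v) = chordLine (algebraMap F K u) (algebraMap F K v) := by
  refine le_antisymm (Submodule.span_le.2 ?_) (Submodule.span_le.2 ?_)
  · rintro _ ⟨x, hx, rfl⟩
    obtain ⟨h1, h2⟩ := mem_chordLine.1 hx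
    refine mem_chordLine.2 ⟨?_, ?_⟩
    · simpa using congrArg (algebraMap F K) h1
    · simpa using congrArg (algebraMap F K) h2
  · rintro x (rfl | rfl)
    · refine Submodule.subset_span ⟨![u ^ 2 - v, u, 1, 0], Submodule.subset_span (by simp), ?_⟩
      simp [V_ext_iff]
    · refine Submodule.subset_span ⟨![-(u * v), -v, 0, 1], Submodule.subset_span (by simp), ?_⟩
      simp [V_ext_iff]

theorem exists_chordLine_of_conjugates [Finite F] {K : Type*} [Field K] [Algebra F K]
    {ℓ : Submodule F (V F)} (hℓ : IsLine ℓ) {t : K} (ht : t ^ Nat.card F ^ 2 = t)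
    (hne : t ^ Nat.card F ≠ t) (he : extend K ℓ =
      Submodule.span K {vec (t : OnePoint K), vec ((t ^ Nat.card F : K) : OnePoint K)}) :
    ∃ u v, (∀ r : F, r ^ 2 - u * r + v ≠ 0) ∧ ℓ = chordLine u v := by
  have := Fintype.ofFinite F
  let φ : K →ₐ[F] K := FiniteField.frobeniusAlgHom F K
  have hφ : ∀ x, φ x = x ^ Nat.card F := fun x => by
    rw [Nat.card_eq_fintype_card]; rfl
  have hφφ : φ (φ t) = t := by rw [hφ, hφ, ← pow_mul, ← sq, ht]
  obtain ⟨u, hu⟩ := mem_range_algebraMap_of_pow_card (F := F) (x := t + φ t) (by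
    rw [← hφ, map_add, hφφ, add_comm])
  obtain ⟨v, hv⟩ := mem_range_algebraMap_of_pow_card (F := F) (x := t * φ t) (by
    rw [← hφ, map_mul, hφφ, mul_comm])
  rw [← hφ] at he hne
  refine ⟨u, v, fun r hr => ?_, ?_⟩
  · have h1 : (algebraMap F K r - t) * (algebraMap F K r - φ t) = 0 := by
      have := congrArg (algebraMap F K) hr
      simp only [map_add, map_sub, map_mul, map_pow, map_zero, hu, hv] at this
      linear_combination this
    rcases mul_eq_zero.1 h1 with h | h
    · rw [← sub_eq_zero.1 h, AlgHom.commutes] at hne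
      exact hne rfl
    · have h' : algebraMap F K r = φ t := sub_eq_zero.1 h
      have h2 := hφφ
      rw [← h', AlgHom.commutes] at h2
      exact hne (h'.symm.trans h2)
  · refine Submodule.eq_of_le_of_finrank_eq (fun x hx => ?_)
      (hℓ.trans (isLine_chordLine _ _).symm)
    have hx' : (fun i => algebraMap F K (x i)) ∈ extend K ℓ :=
      Submodule.subset_span ⟨x, hx, rfl⟩
    rw [he, span_vec_vec (Ne.symm hne), ← hu, ← hv, mem_chordLine] at hx'
    refine mem_chordLine.2 ⟨?_, ?_⟩ <;> apply (algebraMap F K).injective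
    · simpa using hx'.1
    · simpa using hx'.2

theorem exists_conjugates_of_irreducible [Finite F] (K : Type*) [Field K] [Algebra F K]
    [IsAlgClosed K] {u v : F} (hr : ∀ r : F, r ^ 2 - u * r + v ≠ 0) :
    ∃ t : K, t ^ Nat.card F ^ 2 = t ∧ t ^ Nat.card F ≠ t ∧ extend K (chordLine u v) =
      Submodule.span K {vec (t : OnePoint K), vec ((t ^ Nat.card F : K) : OnePoint K)} := by
  have := Fintype.ofFinite F
  let φ : K →ₐ[F] K := FiniteField.frobeniusAlgHom F K
  have hφ : ∀ x, φ x = x ^ Nat.card F := fun x => by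
    rw [Nat.card_eq_fintype_card]; rfl
  let p : Polynomial K :=
    Polynomial.X ^ 2 + Polynomial.C (-algebraMap F K u) * Polynomial.X +
    Polynomial.C (algebraMap F K v)
  have hdeg : p.natDegree = 2 := by
    have := Polynomial.natDegree_quadratic (R := K)
      (b := -algebraMap F K u)
      (c := algebraMap F K v) one_ne_zero
    simpa only [p, map_one, one_mul] using this
  obtain ⟨t, ht⟩ := IsAlgClosed.exists_root p (by
    intro h
    have := Polynomial.natDegree_eq_zero_iff_degree_le_zero.2 h.le
    omega)
  have h0 : t ^ 2 - algebraMap F K u * t + algebraMap F K v = 0 := by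
    have : p.eval t = 0 := ht
    simp [p] at this
    linear_combination this
  have hroot : ∀ x, x ^ 2 - algebraMap F K u * x + algebraMap F K v = 0 →
      φ x ^ 2 - algebraMap F K u * φ x + algebraMap F K v = 0 := fun x hx => by
    simpa using congrArg φ hx
  have hne : ∀ x, x ^ 2 - algebraMap F K u * x + algebraMap F K v = 0 → φ x ≠ x := by
    intro x hx h
    obtain ⟨a, rfl⟩ := mem_range_algebraMap_of_pow_card (F := F) (x := x) (by rw [← hφ, h])
    refine hr a ((algebraMap F K).injective ?_)
    simpa using hx
  have hother : ∀ x, x ^ 2 - algebraMap F K u * x + algebraMap F K v = 0 →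
      φ x = algebraMap F K u - x := by
    intro x hx
    have h1 : (φ x - x) * (φ x - (algebraMap F K u - x)) = 0 := by
      linear_combination hroot x hx - hx
    exact sub_eq_zero.1 ((mul_eq_zero.1 h1).resolve_left (sub_ne_zero.2 (hne x hx)))
  have e1 := hother t h0
  have e2 := hother _ (hroot t h0)
  refine ⟨t, ?_, ?_, ?_⟩
  · rw [sq, pow_mul, ← hφ, ← hφ, e2, e1]; ring
  · rw [← hφ]; exact hne t h0
  · rw [← hφ, span_vec_vec (hne t h0).symm, e1]
    rw [extend_chordLine]
    congr 1
    · ring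
    · linear_combination h0

/-- The imaginary chords are the lines `chordLine u v` with `X² - u X + v` irreducible: the two
conjugate points correspond to the roots of the quadratic. -/
theorem isImaginaryChord_iff [Finite F] {ℓ : Submodule F (V F)} :
    IsImaginaryChord ℓ ↔ ∃ u v, (∀ r : F, r ^ 2 - u * r + v ≠ 0) ∧ ℓ = chordLine u v := by
  constructor
  · rintro ⟨hℓ, t, ht, hne, he⟩
    exact exists_chordLine_of_conjugates hℓ ht hne he
  · rintro ⟨u, v, hr, rfl⟩
    exact ⟨isLine_chordLine _ _, exists_conjugates_of_irreducible _ hr⟩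

end ImaginaryChords

/-! ### The lines of class `EnΓ` -/

section EnGLines

variable {F : Type*} [Field F] [CharP F 3] [Finite F]

omit [Finite F] in
theorem not_le_oscPlane_of_mem_skewLines {ℓ : Submodule F (V F)} (hℓ : ℓ ∈ skewLines F)
    (t : OnePoint F) : ¬ ℓ ≤ oscPlane F t := by
  obtain ⟨a, b, c, d, rfl⟩ := hℓ
  intro h
  have h1 := h ((mem_skewLine (x := ![1, a, b, 0])).2 (by simp))
  have h2 := h ((mem_skewLine (x := ![0, c, d, 1])).2 (by simp))
  induction t using OnePoint.rec with
  | infty => simp [mem_oscPlane_infty] at h2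
  | coe t => simp [mem_oscPlane_coe] at h1

/-- A line that meets the axis lies in an osculating plane, so that the lines in no osculating plane
are those skew to the axis. -/
theorem mem_skewLines_iff {ℓ : Submodule F (V F)} :
    ℓ ∈ skewLines F ↔ IsLine ℓ ∧ ∀ π ∈ oscPlanes F, ¬ ℓ ≤ π := by
  constructor
  · refine fun h => ⟨isLine_of_mem_skewLines h, ?_⟩
    rintro _ ⟨t, rfl⟩
    exact not_le_oscPlane_of_mem_skewLines h t
  · rintro ⟨hℓ, h⟩
    refine mem_skewLines_of_forall hℓ fun x hx h0 h3 => ?_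
    by_contra hne
    have hax : axis F ≤ oscPlane F OnePoint.infty := iInf_le _ _
    obtain ⟨t, c, hc, rfl⟩ := exists_axisPt_of_mem_axis (mem_axis.2 ⟨h0, h3⟩) hne
    rw [Submodule.smul_mem_iff _ hc] at hx
    obtain ⟨w, hw, hwa⟩ : ∃ w ∈ ℓ, w ∉ axis F := by
      by_contra! h'
      exact h _ ⟨OnePoint.infty, rfl⟩ (le_trans h' hax)
    obtain ⟨s, y, z, d, hd, rfl⟩ := exists_pt_of_notMem_axis hwa
    rw [Submodule.smul_mem_iff _ hd] at hw
    refine h _ ⟨s, rfl⟩ ?_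
    rw [eq_span_axisPt_pt hℓ hx hw, Submodule.span_le]
    rintro x (rfl | rfl)
    · exact (Submodule.mem_iInf _).1 (axisPt_mem_axis t) s
    · exact pt_mem_oscPlane.2 rfl

theorem mem_EnGLines_iff {ℓ : Submodule F (V F)} :
    ℓ ∈ EnGLines F ↔ ℓ ∈ skewLines F ∧ (∀ t, vec t ∉ ℓ) ∧ ¬ IsImaginaryChord ℓ := by
  constructor
  · rintro ⟨h1, h2, h3⟩
    exact ⟨mem_skewLines_iff.2 ⟨h1.1, h3⟩, (isExternal_iff.1 h1).2,
      fun h => h2 (Or.inr (Or.inr h))⟩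
  · rintro ⟨h1, h2, h3⟩
    have h1' := mem_skewLines_iff.1 h1
    have hext : IsExternal ℓ := isExternal_iff.2 ⟨h1'.1, h2⟩
    refine ⟨hext, ?_, h1'.2⟩
    rintro (⟨-, P, hP, -, -, -, hPℓ, -⟩ | ⟨t, rfl⟩ | h)
    · exact hext.2 P hP hPℓ
    · exact h2 t (Submodule.subset_span (by simp))
    · exact h3 h

/-- The `EnΓ`-lines through a `TO`-point are the skew lines through it that avoid the cubic, since
a `TO`-point is on no imaginary chord. -/
theorem numLines_EnGLines {p : ℙ F (V F)} (hp : p ∈ TOPoints F) :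
    numLines (EnGLines F) p = Nat.card F ^ 2 - Nat.card F := by
  obtain ⟨s, b, hb, rfl⟩ := mem_TOPoints_iff.1 hp
  rw [← ncard_unisecants s b, numLines]
  congr 1
  ext ℓ
  change ℓ ∈ EnGLines F ∧ _ ↔ _
  rw [mem_EnGLines_iff, onSub_mk]
  constructor
  · rintro ⟨⟨h1, h2, -⟩, h3⟩
    exact ⟨h1, h3, fun r _ => h2 r⟩
  · rintro ⟨h1, h2, h3⟩
    refine ⟨⟨h1, fun t ht => ?_, fun h => ?_⟩, h2⟩
    · by_cases hts : t = s
      -- a line through `P(s)` and the given point is the tangent, which meets the axis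
      · subst hts
        refine axisPt_notMem_of_mem_skewLines h1 t ((Submodule.smul_mem_iff _ hb).1 ?_)
        have h4 := pt_add_axisPt_self t 0 0 b
        rw [zero_add] at h4
        rw [← h4, ← vec_eq_pt] at h2
        simpa using Submodule.sub_mem _ h2 ht
      · exact h3 t hts ht
    · obtain ⟨u, v, hr, rfl⟩ := isImaginaryChord_iff.1 h
      obtain ⟨r, -, h4⟩ := exists_root_of_pt_mem_chordLine h2
      exact hr r h4

variable (F) in
/-- The real and imaginary chords not through `P(∞)`. -/
def finiteChords : Set (Submodule F (V F)) :=
  {ℓ | ∃ u w : F, w ≠ 0 ∧ ℓ = chordLine u (u ^ 2 - w)}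

variable (F) in
/-- The real chords through `P(∞)`. -/
def infiniteChords : Set (Submodule F (V F)) :=
  {ℓ | ∃ t : F, ℓ = Submodule.span F {vec OnePoint.infty, vec (t : OnePoint F)}}

omit [CharP F 3] in
theorem ncard_finiteChords :
    (finiteChords F).ncard = Nat.card F * (Nat.card F - 1) := by
  have h : finiteChords F = (fun x : F × F => chordLine x.1 (x.1 ^ 2 - x.2)) ''
      (Set.univ ×ˢ {w | w ≠ 0}) := by
    ext ℓ
    constructor
    · rintro ⟨u, w, hw, rfl⟩; exact ⟨(u, w), ⟨trivial, hw⟩, rfl⟩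
    · rintro ⟨⟨u, w⟩, ⟨-, hw⟩, rfl⟩; exact ⟨u, w, hw, rfl⟩
  rw [h, Set.ncard_image_of_injective, Set.ncard_prod, Set.ncard_univ, ncard_ne]
  rintro ⟨u, w⟩ ⟨u', w'⟩ h
  obtain ⟨rfl, h⟩ := chordLine_inj h
  exact congrArg _ (sub_right_injective h)

omit [Finite F] in
theorem infiniteChords_subset : infiniteChords F ⊆ skewLines F := by
  rintro _ ⟨t, rfl⟩
  rw [vec_eq_pt, vec_eq_pt]
  exact span_pt_pt_mem_skewLines (OnePoint.infty_ne_coe t) _ _ _ _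

omit [Finite F] in
theorem ncard_infiniteChords : (infiniteChords F).ncard = Nat.card F := by
  have h : infiniteChords F = (fun t : F => Submodule.span F {vec OnePoint.infty,
      vec (t : OnePoint F)}) '' Set.univ := by
    ext ℓ
    constructor
    · rintro ⟨t, rfl⟩; exact ⟨t, trivial, rfl⟩
    · rintro ⟨t, -, rfl⟩; exact ⟨t, rfl⟩
  rw [h, Set.ncard_image_of_injective, Set.ncard_univ]
  intro t t' e
  by_contra hne
  have e' : Submodule.span F {vec OnePoint.infty, vec (t : OnePoint F)} =
    Submodule.span F {vec OnePoint.infty, vec (t' : OnePoint F)} := e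
  have h1 : vec (t : OnePoint F) ∈
      Submodule.span F {vec OnePoint.infty, vec (t : OnePoint F)} :=
    Submodule.subset_span (by simp)
  have h2 : vec (t' : OnePoint F) ∈
      Submodule.span F {vec OnePoint.infty, vec (t : OnePoint F)} := by
    rw [e']; exact Submodule.subset_span (by simp)
  have h3 : vec OnePoint.infty ∈
      Submodule.span F {vec OnePoint.infty, vec (t : OnePoint F)} :=
    Submodule.subset_span (by simp)
  rw [eq_chordLine_of_mem (isLine_of_mem_skewLines (infiniteChords_subset ⟨t, rfl⟩)) hne h1 h2]
    at h3
  exact vec_infty_notMem_chordLine _ _ h3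

omit [CharP F 3] [Finite F] in
theorem finiteChords_subset : finiteChords F ⊆ skewLines F := by
  rintro _ ⟨u, w, hw, rfl⟩
  exact chordLine_mem_skewLines (by simpa using hw)

theorem skewLines_eq_union :
    skewLines F = EnGLines F ∪ (⋃ s, unisecants s 0) ∪ finiteChords F ∪ infiniteChords F := by
  have h3 := three_eq_zero F
  refine Set.Subset.antisymm (fun ℓ hℓ => ?_) ?_
  · have hl := isLine_of_mem_skewLines hℓ
    by_cases hi : IsImaginaryChord ℓ
    · obtain ⟨u, v, hr, rfl⟩ := isImaginaryChord_iff.1 hi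
      -- in characteristic `3` a quadratic with `v = u²` has the double root `-u`
      refine Or.inl (Or.inr ⟨u, u ^ 2 - v, fun h => hr (-u) ?_, by rw [sub_sub_cancel]⟩)
      linear_combination u ^ 2 * h3 - h
    by_cases h0 : ∀ t, vec t ∉ ℓ
    · exact Or.inl (Or.inl (Or.inl (mem_EnGLines_iff.2 ⟨hℓ, h0, hi⟩)))
    push Not at h0
    obtain ⟨s, hs⟩ := h0
    by_cases h1 : ∀ r, r ≠ s → vec r ∉ ℓ
    · exact Or.inl (Or.inl (Or.inr (Set.mem_iUnion.2 ⟨s, hℓ, by rwa [← vec_eq_pt], h1⟩)))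
    push Not at h1
    obtain ⟨r, hrs, hr⟩ := h1
    have hinf : ∀ t : F, vec OnePoint.infty ∈ ℓ → vec (t : OnePoint F) ∈ ℓ →
        ℓ ∈ infiniteChords F := by
      intro t h1 h2
      refine ⟨t, ?_⟩
      rw [vec_eq_pt] at h1 h2 ⊢
      rw [vec_eq_pt]
      exact eq_span_pt_pt hl (OnePoint.infty_ne_coe t) h1 h2
    induction s using OnePoint.rec with
    | infty =>
      induction r using OnePoint.rec with
      | infty => exact absurd rfl hrs
      | coe r => exact Or.inr (hinf r hs hr)
    | coe s =>
      induction r using OnePoint.rec with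
      | infty => exact Or.inr (hinf s hr hs)
      | coe r =>
        have hne : r ≠ s := fun e => hrs (by rw [e])
        refine Or.inl (Or.inr ⟨r + s, (r - s) ^ 2, pow_ne_zero 2 (sub_ne_zero.2 hne), ?_⟩)
        rw [eq_chordLine_of_mem hl hne hr hs]
        congr 1
        linear_combination -(r * s) * h3
  · refine Set.union_subset (Set.union_subset (Set.union_subset ?_ ?_) finiteChords_subset)
      infiniteChords_subset
    · exact fun ℓ h => (mem_EnGLines_iff.1 h).1
    · exact Set.iUnion_subset fun s ℓ h => h.1

omit [Finite F] in
/-- A finite chord through one point of the cubic is through a second one. -/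
theorem exists_other_vec_mem {ℓ : Submodule F (V F)} (hℓ : ℓ ∈ finiteChords F) {s : OnePoint F}
    (hs : vec s ∈ ℓ) : ∃ r, r ≠ s ∧ vec r ∈ ℓ := by
  have h3 := three_eq_zero F
  obtain ⟨u, w, hw, rfl⟩ := hℓ
  induction s using OnePoint.rec with
  | infty => exact absurd hs (vec_infty_notMem_chordLine _ _)
  | coe s =>
    rw [vec_mem_chordLine] at hs
    refine ⟨((u - s : F) : OnePoint F), fun e => hw ?_, vec_mem_chordLine.2 ?_⟩
    · have e' : u = s + s := by linear_combination OnePoint.coe_injective e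
      subst e'
      linear_combination s ^ 2 * h3 - hs
    · linear_combination hs

theorem ncard_EnGLines_add :
    (EnGLines F).ncard + (Nat.card F + 1) * (Nat.card F ^ 2 - Nat.card F) +
      Nat.card F * (Nat.card F - 1) + Nat.card F = Nat.card F ^ 4 := by
  have := Fintype.ofFinite (OnePoint F)
  have hU : (⋃ s : OnePoint F, unisecants s 0).ncard =
      (Nat.card F + 1) * (Nat.card F ^ 2 - Nat.card F) := by
    rw [Set.ncard_iUnion_of_finite (fun _ => Set.toFinite _), finsum_eq_sum_of_fintype]
    · simp only [ncard_unisecants, Finset.sum_const, Finset.card_univ, smul_eq_mul]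
      rw [← Nat.card_eq_fintype_card, card_onePoint]
    · intro s r hsr
      rw [Function.onFun, Set.disjoint_left]
      rintro ℓ ⟨-, hs, -⟩ ⟨-, -, hr⟩
      rw [← vec_eq_pt] at hs
      exact hr s hsr hs
  rw [← ncard_skewLines, skewLines_eq_union, Set.ncard_union_eq, Set.ncard_union_eq,
    Set.ncard_union_eq, hU, ncard_finiteChords, ncard_infiniteChords]
  · rw [Set.disjoint_left]
    intro ℓ h1 h2
    obtain ⟨s, -, hs, -⟩ := Set.mem_iUnion.1 h2
    rw [← vec_eq_pt] at hs
    exact (mem_EnGLines_iff.1 h1).2.1 s hs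
  · rw [Set.disjoint_left]
    rintro ℓ (h1 | h1) h2
    · obtain ⟨-, h3, h4⟩ := mem_EnGLines_iff.1 h1
      obtain ⟨u, w, hw, rfl⟩ := h2
      exact h4 (isImaginaryChord_iff.2
        ⟨_, _, fun r hr => h3 r (vec_mem_chordLine.2 hr), rfl⟩)
    · obtain ⟨s, -, hs, h⟩ := Set.mem_iUnion.1 h1
      rw [← vec_eq_pt] at hs
      obtain ⟨r, hr, hrℓ⟩ := exists_other_vec_mem h2 hs
      exact h r hr hrℓ
  · rw [Set.disjoint_left]
    rintro ℓ h ⟨t, rfl⟩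
    have hi : vec OnePoint.infty ∈ Submodule.span F {vec OnePoint.infty, vec (t : OnePoint F)} :=
      Submodule.subset_span (by simp)
    have ht : vec (t : OnePoint F) ∈
        Submodule.span F {vec OnePoint.infty, vec (t : OnePoint F)} :=
      Submodule.subset_span (by simp)
    rcases h with (h | h) | h
    · exact (mem_EnGLines_iff.1 h).2.1 t ht
    · obtain ⟨s, -, hs, h⟩ := Set.mem_iUnion.1 h
      by_cases e : (t : OnePoint F) = s
      · exact h _ (e ▸ OnePoint.infty_ne_coe t) hi
      · exact h _ e ht
    · obtain ⟨u, w, -, h⟩ := h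
      rw [h] at hi
      exact vec_infty_notMem_chordLine _ _ hi

omit [CharP F 3] in
/-- Counting the incident pairs of points of `M` and lines of `L` in two ways. -/
theorem finsum_numPoints_eq (M : Set (ℙ F (V F))) (L : Set (Submodule F (V F))) {k : ℕ}
    (h : ∀ p ∈ M, numLines L p = k) : ∑ᶠ ℓ ∈ L, (numPoints M ℓ : ℚ) = M.ncard * k := by
  classical
  have hL := L.toFinite
  have hM := M.toFinite
  rw [finsum_mem_eq_finite_toFinset_sum _ hL, ← Nat.cast_sum, ← Nat.cast_mul]
  congr 1
  have e1 : ∀ ℓ : Submodule F (V F), numPoints M ℓ =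
      (Finset.bipartiteAbove (fun ℓ p => OnSub p ℓ) hM.toFinset ℓ).card := by
    intro ℓ
    rw [numPoints, ← Set.ncard_coe_finset]
    congr 1; ext p; simp [Finset.bipartiteAbove]
  have e2 : ∀ p : ℙ F (V F), numLines L p =
      (Finset.bipartiteBelow (fun ℓ p => OnSub p ℓ) hL.toFinset p).card := by
    intro p
    rw [numLines, ← Set.ncard_coe_finset]
    congr 1; ext ℓ; simp [Finset.bipartiteBelow]
  rw [Finset.sum_congr rfl fun ℓ _ => e1 ℓ,
    Finset.sum_card_bipartiteAbove_eq_sum_card_bipartiteBelow,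
    Finset.sum_congr rfl fun p hp => (e2 p).symm.trans (h p (hM.mem_toFinset.1 hp)),
    Finset.sum_const, smul_eq_mul, Set.ncard_eq_toFinset_card M hM]

end EnGLines

/-! ### Totals and averages -/

theorem cast_sq_sub_self (q : ℕ) : ((q ^ 2 - q : ℕ) : ℚ) = (q : ℚ) ^ 2 - q := by
  rw [Nat.cast_sub (Nat.le_self_pow two_ne_zero _), Nat.cast_pow]

section Totals

variable {F : Type*} [Field F] [Finite F]

theorem charP_three_of_dvd_card (h : 3 ∣ Nat.card F) : CharP F 3 := by
  have := Fintype.ofFinite F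
  obtain ⟨p, hp⟩ := CharP.exists F
  obtain ⟨n, hprime, hcard⟩ := FiniteField.card F p
  rw [Nat.card_eq_fintype_card, hcard] at h
  have h3 : 3 = p := (Nat.prime_dvd_prime_iff_eq Nat.prime_three hprime).1
    (Nat.prime_three.dvd_of_dvd_pow h)
  rwa [h3]

variable [CharP F 3]

theorem EALines_eq {n : F} (hn0 : n ≠ 0) (hn : ∀ b : F, b ≠ 0 → ∃ d, d ≠ 0 ∧
    (b = d ^ 2 * 1 ∨ b = d ^ 2 * n)) :
    transversalLines F ∪ concurrentLines 1 ∪ concurrentLines n = EALines F :=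
  (Set.union_subset (Set.union_subset transversalLines_subset
    (concurrentLines_subset one_ne_zero)) (concurrentLines_subset hn0)).antisymm
    (EALines_subset hn)

theorem numLines_EALines {p : ℙ F (V F)} (hp : p ∈ TOPoints F) :
    numLines (EALines F) p = Nat.card F := by
  obtain ⟨n, hns, hn⟩ := exists_nonsquare_dichotomy F
  have hn0 : n ≠ 0 := by rintro rfl; exact hns IsSquare.zero
  rw [← numLines_transversal hp, numLines, numLines]
  congr 1
  ext ℓ
  refine and_congr_left fun hpℓ => ⟨fun h => ?_, fun h => transversalLines_subset h⟩
  obtain ⟨s, b, -, rfl⟩ := mem_TOPoints_iff.1 hp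
  rw [onSub_mk] at hpℓ
  rw [← EALines_eq hn0 hn] at h
  rcases h with (h | h) | h
  · exact h
  · exact absurd hpℓ (pt_notMem_concurrent one_ne_zero s h)
  · exact absurd hpℓ (pt_notMem_concurrent hn0 s h)

theorem ncard_EALines : ((EALines F).ncard : ℚ) =
    ((Nat.card F : ℚ) + 1) * ((Nat.card F : ℚ) ^ 2 - 1) := by
  obtain ⟨n, hns, hn⟩ := exists_nonsquare_dichotomy F
  have hn0 : n ≠ 0 := by rintro rfl; exact hns IsSquare.zero
  have h1 := two_mul_ncard_concurrentLines (one_ne_zero (α := F))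
  have h2 := two_mul_ncard_concurrentLines hn0
  obtain ⟨k, hk⟩ := Nat.exists_eq_add_of_lt (Nat.card_pos (α := F))
  rw [← EALines_eq hn0 hn, Set.ncard_union_eq (Set.disjoint_union_left.2
    ⟨disjoint_transversal_concurrent n, disjoint_concurrent hns⟩), Set.ncard_union_eq
    (disjoint_transversal_concurrent 1), ncard_transversalLines]
  rw [hk] at h1 h2 ⊢
  simp only [zero_add, Nat.add_sub_cancel] at h1 h2 ⊢
  have h1' : (2 : ℚ) * ((concurrentLines (1 : F)).ncard : ℚ) = (k + 1 + 1) * k := by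
    exact_mod_cast h1
  have h2' : (2 : ℚ) * ((concurrentLines n).ncard : ℚ) = (k + 1 + 1) * k := by
    exact_mod_cast h2
  push_cast
  linear_combination (h1' + h2') / 2

theorem avgPoints_EALines :
    avgPoints (TOPoints F) (EALines F) = (Nat.card F : ℚ) / (Nat.card F + 1) := by
  have hq : (1 : ℚ) < Nat.card F := by exact_mod_cast Finite.one_lt_card (α := F)
  rw [avgPoints, finsum_numPoints_eq _ _ fun p hp => numLines_EALines hp, ncard_TOPoints,
    ncard_EALines, Nat.cast_mul, Nat.cast_sub Finite.one_lt_card.le]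
  have h1 : (Nat.card F : ℚ) + 1 ≠ 0 := by positivity
  have h2 : (Nat.card F : ℚ) ^ 2 - 1 ≠ 0 := by nlinarith
  push_cast
  rw [div_eq_div_iff (mul_ne_zero h1 h2) h1]
  ring

/-- The number of incident pairs of `TO`-points and `EnΓ`-lines equals the number of
`EnΓ`-lines, `(q² - 1)(q² - q)`. -/
theorem avgPoints_EnGLines : avgPoints (TOPoints F) (EnGLines F) = 1 := by
  have hq : (1 : ℚ) < Nat.card F := by exact_mod_cast Finite.one_lt_card (α := F)
  have h := congrArg (Nat.cast : ℕ → ℚ) (ncard_EnGLines_add (F := F))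
  rw [Nat.cast_add, Nat.cast_add, Nat.cast_add, Nat.cast_mul, Nat.cast_mul,
    cast_sq_sub_self, Nat.cast_sub Finite.one_lt_card.le] at h
  push_cast at h
  have hcard : ((EnGLines F).ncard : ℚ) =
      ((Nat.card F : ℚ) + 1) * (Nat.card F - 1) * ((Nat.card F : ℚ) ^ 2 - Nat.card F) := by
    linear_combination h
  rw [avgPoints, finsum_numPoints_eq _ _ fun p hp => numLines_EnGLines hp, ncard_TOPoints,
    cast_sq_sub_self, hcard, Nat.cast_mul, Nat.cast_sub Finite.one_lt_card.le]
  push_cast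
  refine div_self (mul_ne_zero (mul_ne_zero (by positivity) (sub_ne_zero.2 hq.ne')) ?_)
  nlinarith

end Totals
end TwistedCubic

theorem mainTheorem4 (F : Type*) [Field F] [Finite F] (q : ℕ) (hq : Nat.card F = q)
    (h3 : q ≡ 0 [MOD 3]) (h5 : 5 ≤ q) :
    ∃ EA₁ EA₂ EA₃ : Set (Submodule F (TwistedCubic.V F)),
      -- the `EA`-lines form exactly three orbits, labelled by their sizes
      (TwistedCubic.IsLineOrbit EA₁ ∧ TwistedCubic.IsLineOrbit EA₂ ∧
        TwistedCubic.IsLineOrbit EA₃ ∧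
        Disjoint EA₁ EA₂ ∧ Disjoint EA₁ EA₃ ∧ Disjoint EA₂ EA₃ ∧
        EA₁ ∪ EA₂ ∪ EA₃ = TwistedCubic.EALines F ∧
        (EA₁.ncard : ℚ) = (q : ℚ) ^ 3 - q ∧
        (EA₂.ncard : ℚ) = ((q : ℚ) ^ 2 - 1) / 2 ∧
        (EA₃.ncard : ℚ) = ((q : ℚ) ^ 2 - 1) / 2) ∧
      -- the numbers of lines through every `TO`-point
      (∀ p ∈ TwistedCubic.TOPoints F,
        TwistedCubic.numLines (TwistedCubic.EALines F) p = q ∧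
        TwistedCubic.numLines EA₁ p = q ∧
        TwistedCubic.numLines EA₂ p = 0 ∧
        TwistedCubic.numLines EA₃ p = 0 ∧
        (TwistedCubic.numLines (TwistedCubic.EnGLines F) p : ℚ) = (q : ℚ) ^ 2 - q) ∧
      -- the average numbers of `TO`-points on `EA`-lines and on `EnΓ`-lines
      TwistedCubic.avgPoints (TwistedCubic.TOPoints F) (TwistedCubic.EALines F)
        = (q : ℚ) / (q + 1) ∧
      TwistedCubic.avgPoints (TwistedCubic.TOPoints F) (TwistedCubic.EnGLines F) = 1 ∧
      -- the exact numbers of `TO`-points on the lines of each orbit of `EA`-lines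
      (∀ ℓ ∈ EA₁, TwistedCubic.numPoints (TwistedCubic.TOPoints F) ℓ = 1) ∧
      (∀ ℓ ∈ EA₂, TwistedCubic.numPoints (TwistedCubic.TOPoints F) ℓ = 0) ∧
      (∀ ℓ ∈ EA₃, TwistedCubic.numPoints (TwistedCubic.TOPoints F) ℓ = 0) := by
  subst hq
  have hdvd : 3 ∣ Nat.card F := (Nat.modEq_zero_iff_dvd).1 h3
  have hF : 5 < Nat.card F := by omega
  have := TwistedCubic.charP_three_of_dvd_card hdvd
  obtain ⟨n, hns, hn⟩ := TwistedCubic.exists_nonsquare_dichotomy F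
  have hn0 : n ≠ 0 := by rintro rfl; exact hns IsSquare.zero
  have hcast : ((Nat.card F - 1 : ℕ) : ℚ) = (Nat.card F : ℚ) - 1 := by
    rw [Nat.cast_sub (by omega), Nat.cast_one]
  have hcard : ∀ c : F, c ≠ 0 → ((TwistedCubic.concurrentLines c).ncard : ℚ) =
      ((Nat.card F : ℚ) ^ 2 - 1) / 2 := by
    intro c hc
    have h := congrArg (Nat.cast : ℕ → ℚ) (TwistedCubic.two_mul_ncard_concurrentLines hc)
    rw [Nat.cast_mul, Nat.cast_mul, hcast] at h
    push_cast at h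
    linear_combination h / 2
  refine ⟨TwistedCubic.transversalLines F, TwistedCubic.concurrentLines 1,
    TwistedCubic.concurrentLines n,
    ⟨TwistedCubic.isLineOrbit_transversalLines hF, TwistedCubic.isLineOrbit_concurrentLines hF 1,
      TwistedCubic.isLineOrbit_concurrentLines hF n,
      TwistedCubic.disjoint_transversal_concurrent 1,
      TwistedCubic.disjoint_transversal_concurrent n, TwistedCubic.disjoint_concurrent hns,
      TwistedCubic.EALines_eq hn0 hn, ?_, hcard 1 one_ne_zero, hcard n hn0⟩,
    fun p hp => ⟨TwistedCubic.numLines_EALines hp, TwistedCubic.numLines_transversal hp,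
      TwistedCubic.numLines_concurrent one_ne_zero hp, TwistedCubic.numLines_concurrent hn0 hp, ?_⟩,
    TwistedCubic.avgPoints_EALines, TwistedCubic.avgPoints_EnGLines,
    fun ℓ hℓ => TwistedCubic.numPoints_transversal hℓ,
    fun ℓ hℓ => TwistedCubic.numPoints_concurrent one_ne_zero hℓ,
    fun ℓ hℓ => TwistedCubic.numPoints_concurrent hn0 hℓ⟩
  · rw [TwistedCubic.ncard_transversalLines, Nat.cast_mul, Nat.cast_mul, hcast]
    push_cast
    ring
  · rw [TwistedCubic.numLines_EnGLines hp, TwistedCubic.cast_sq_sub_self]
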